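/- Let $n>2$ and $k\ge 0$ be integers, let $\rho>0$ and $\epsilon>0$, and let $h=(h_{ij})$ be a symmetric 2-tensor field of class $C^{2(k+1)}$ on $\{x\in\mathbb{R}^n : |x|>\rho\}$, with components taken in the standard Euclidean coordinates. Write $\Delta=\sum_l\partial_l^2$ for the flat Laplacian, acting on each component, and $(\delta h)_j=\sum_i\partial_i h_{ij}$ for the divergence. Suppose that $$\Delta^{k+1}h=0,\qquad \delta h=0\qquad\text{for } |x|>\rho,$$ and that $h=O(|x|^{1-\epsilon})$ as $|x|\to\infty$. Suppose moreover that one of the following holds: 1. $1\le k\le \frac n2-1$; 2. $n=3$ and $k=1$; 3. $k=0$ and $\mathrm{tr}(h)=\sum_i h_{ii}=0$ for $|x|>\rho$. Then there is a constant symmetric 2-tensor $h_c$ such that $$h=h_c+O\left(|x|^{2k-n}\right)\qquad\text{as } |x|\to\infty.$$ -/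

import Mathlib

noncomputable section

/-- The open exterior region of points of `ℝⁿ` with `|x| > ρ`. -/
def exteriorRegion (n : ℕ) (ρ : ℝ) : Set (EuclideanSpace ℝ (Fin n)) :=
  {x | ρ < ‖x‖}

/-- A (covariant) 2-tensor field on `ℝⁿ`, given by its components `h x i j` in the standard
Euclidean coordinates. -/
abbrev TensorField2 (n : ℕ) : Type :=
  EuclideanSpace ℝ (Fin n) → Matrix (Fin n) (Fin n) ℝ

namespace TensorField2

/-- The rough (analyst's) Laplacian of a 2-tensor field for the flat metric; in Euclidean
coordinates it is the Laplacian of each component. -/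
def laplacian {n : ℕ} (h : TensorField2 n) : TensorField2 n :=
  fun x => Matrix.of fun i j =>
    Laplacian.laplacian (fun y : EuclideanSpace ℝ (Fin n) => h y i j) x

/-- The divergence `(δh)_j = ∑ i, ∂_i h_{ij}` of a 2-tensor field for the flat metric. -/
def divergence {n : ℕ} (h : TensorField2 n) (x : EuclideanSpace ℝ (Fin n)) : Fin n → ℝ :=
  fun j => ∑ i : Fin n,
    fderiv ℝ (fun y : EuclideanSpace ℝ (Fin n) => h y i j) x (EuclideanSpace.single i 1)

/-- `h` is of class `C^m` on `s`, i.e. each of its components is. -/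
def IsCm {n : ℕ} (m : ℕ) (h : TensorField2 n) (s : Set (EuclideanSpace ℝ (Fin n))) : Prop :=
  ∀ i j : Fin n, ContDiffOn ℝ (m : WithTop ℕ∞) (fun x => h x i j) s

/-- `h = O(|x|^a)` as `|x| → ∞`, for each component of `h`. -/
def IsBigOPow {n : ℕ} (h : TensorField2 n) (a : ℝ) : Prop :=
  ∀ i j : Fin n, Asymptotics.IsBigO (Bornology.cobounded (EuclideanSpace ℝ (Fin n)))
    (fun x => h x i j) (fun x => ‖x‖ ^ a)

end TensorField2

end

open MeasureTheory Filter Topology Laplacian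
open scoped ContDiff

/-! ### Calculus of the iterated Laplacian and integration by parts -/

section LaplacianBasics

/-! Cut `h` off near the ball: `u = χ h` lives on all of ℝⁿ and each `f_ij = Δ^(k+1) u_ij` has
compact support. Heuristically `u` is a constant plus the convolution of `f` with a fundamental
solution of size |x|^(2k+2-n). Each order of vanishing moments of `f` gains one power of |x|, so
vanishing moments of orders 0 and 1 give |x|^(2k-n).

The moments vanish because of the divergence condition: if Δ^(k+1) p = 0, then ∑_i ∫ f_ij ∂_i p = 0
(`sum_integral_iterate_laplacian_mul_partialDeriv`). Linear p kill the zeroth moments. Quadratic p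
make the first moments M_ijl = ∫ f_ij y_l antisymmetric in (i, l); they are symmetric in (i, j),
hence zero. For k = 0 only harmonic quadratics are allowed, and the trace condition together with n
≠ 2 supplies what is missing.

The convolution formula is replaced by a regularised kernel Φ_t with gradient (t + |y|²)^(k-n/2) y,
for which Δ^(k+1) Φ_t is an explicit multiple of an approximate identity
(`iterate_laplacian_radialPotential`). The difference Φ_t(y-x) - Φ_t(y-x') decays one order faster
than Φ_t, just enough for Green's identity against growth |y|^(1-ε)
(`integral_iterate_laplacian_mul_of_decay`). Bounds on the `f` side are uniform in t, so t → 0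
yields |u(x) - u(x')| ≤ C(|x|^(2k-n) + |x'|^(2k-n)) (`abs_sub_le_of_vanishing_moments`), and `u` is
Cauchy at infinity. The restrictions on (n, k) ensure 2k + 1 ≤ n and a nonzero normalising constant
`bubbleConst`. -/

theorem two_le_contDiff_infty : (2 : WithTop ℕ∞) ≤ ∞ :=
  WithTop.coe_le_coe.2 le_top

theorem cast_two_mul_succ (m : ℕ) :
    ((2 * (m + 1) : ℕ) : WithTop ℕ∞) = ((2 * m : ℕ) : WithTop ℕ∞) + 2 := by
  rw [mul_add]; push_cast; norm_num

variable {n : ℕ}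

/-- The partial derivative in the `i`-th coordinate direction. -/
noncomputable def partialDeriv (i : Fin n) (f : EuclideanSpace ℝ (Fin n) → ℝ) :
    EuclideanSpace ℝ (Fin n) → ℝ :=
  fun x => fderiv ℝ f x (EuclideanSpace.single i 1)

theorem contDiff_partialDeriv {N : WithTop ℕ∞} {f : EuclideanSpace ℝ (Fin n) → ℝ}
    (hf : ContDiff ℝ (N + 1) f) (i : Fin n) : ContDiff ℝ N (partialDeriv i f) :=
  (hf.fderiv_right le_rfl).clm_apply contDiff_const

theorem contDiff_infty_partialDeriv {f : EuclideanSpace ℝ (Fin n) → ℝ}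
    (hf : ContDiff ℝ ∞ f) (i : Fin n) : ContDiff ℝ ∞ (partialDeriv i f) :=
  (hf.fderiv_right (m := ∞) le_rfl).clm_apply contDiff_const

theorem laplacian_eq_sum_partialDeriv {f : EuclideanSpace ℝ (Fin n) → ℝ} (hf : ContDiff ℝ 2 f) :
    Δ f = ∑ i, partialDeriv i (partialDeriv i f) := by
  rw [InnerProductSpace.laplacian_eq_iteratedFDeriv_orthonormalBasis f
    (EuclideanSpace.basisFun (Fin n) ℝ)]
  ext x
  rw [Finset.sum_apply]
  refine Finset.sum_congr rfl fun i _ => ?_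
  have hd : DifferentiableAt ℝ (fderiv ℝ f) x :=
    ((hf.fderiv_right (m := 1) (by norm_num)).differentiable (by norm_num)) x
  rw [iteratedFDeriv_two_apply]
  unfold partialDeriv
  simp only [EuclideanSpace.basisFun_apply, Matrix.cons_val_zero,
    Matrix.cons_val_one]
  rw [fderiv_clm_apply hd (differentiableAt_const _)]
  simp

theorem contDiff_laplacian {N : WithTop ℕ∞} {f : EuclideanSpace ℝ (Fin n) → ℝ}
    (hf : ContDiff ℝ (N + 2) f) : ContDiff ℝ N (Δ f) := by
  rw [laplacian_eq_sum_partialDeriv (hf.of_le (by simp))]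
  have h2 : N + 2 = N + 1 + 1 := by rw [add_assoc]; norm_num
  have : ContDiff ℝ N fun x => ∑ i, partialDeriv i (partialDeriv i f) x :=
    ContDiff.sum fun i _ => contDiff_partialDeriv (contDiff_partialDeriv (h2 ▸ hf) i) i
  convert this using 1
  ext x
  simp

theorem contDiff_infty_laplacian {f : EuclideanSpace ℝ (Fin n) → ℝ}
    (hf : ContDiff ℝ ∞ f) : ContDiff ℝ ∞ (Δ f) :=
  contDiff_laplacian (N := ∞) hf

theorem contDiff_infty_iterate_laplacian {f : EuclideanSpace ℝ (Fin n) → ℝ}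
    (hf : ContDiff ℝ ∞ f) (m : ℕ) : ContDiff ℝ ∞ (Δ^[m] f) := by
  induction m with
  | zero => exact hf
  | succ m ih => rw [Function.iterate_succ_apply']; exact contDiff_infty_laplacian ih

theorem continuous_iterate_laplacian (m : ℕ) {f : EuclideanSpace ℝ (Fin n) → ℝ}
    (hf : ContDiff ℝ ((2 * m : ℕ) : WithTop ℕ∞) f) : Continuous (Δ^[m] f) := by
  induction m generalizing f with
  | zero => exact hf.continuous
  | succ m ih =>
    rw [Function.iterate_succ_apply]
    exact ih (contDiff_laplacian (cast_two_mul_succ m ▸ hf))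

theorem iterate_laplacian_congr_nhds {f g : EuclideanSpace ℝ (Fin n) → ℝ}
    {x : EuclideanSpace ℝ (Fin n)} (h : f =ᶠ[𝓝 x] g) (m : ℕ) : Δ^[m] f =ᶠ[𝓝 x] Δ^[m] g := by
  induction m with
  | zero => exact h
  | succ m ih =>
    rw [Function.iterate_succ_apply', Function.iterate_succ_apply']
    exact InnerProductSpace.laplacian_congr_nhds ih

theorem TensorField2.iterate_laplacian_apply (h : TensorField2 n) (m : ℕ)
    (x : EuclideanSpace ℝ (Fin n)) (i j : Fin n) :
    (TensorField2.laplacian^[m] h) x i j =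
      (Δ^[m] (fun y : EuclideanSpace ℝ (Fin n) => h y i j)) x := by
  induction m generalizing h with
  | zero => rfl
  | succ m ih =>
    rw [Function.iterate_succ_apply, Function.iterate_succ_apply, ih]
    rfl

theorem laplacian_comp_sub (f : EuclideanSpace ℝ (Fin n) → ℝ) (a : EuclideanSpace ℝ (Fin n)) :
    Δ (fun y => f (y - a)) = fun y => (Δ f) (y - a) := by
  simp only [InnerProductSpace.laplacian_eq_iteratedFDeriv_stdOrthonormalBasis,
    iteratedFDeriv_comp_sub]

theorem iterate_laplacian_comp_sub (m : ℕ) (f : EuclideanSpace ℝ (Fin n) → ℝ)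
    (a : EuclideanSpace ℝ (Fin n)) :
    Δ^[m] (fun y => f (y - a)) = fun y => (Δ^[m] f) (y - a) := by
  induction m with
  | zero => rfl
  | succ m ih =>
    rw [Function.iterate_succ_apply', Function.iterate_succ_apply', ih, laplacian_comp_sub]

theorem laplacian_linear_combination {f g : EuclideanSpace ℝ (Fin n) → ℝ}
    (hf : ContDiff ℝ 2 f) (hg : ContDiff ℝ 2 g) (α β : ℝ) :
    Δ (fun y => α * f y + β * g y) = fun y => α * (Δ f) y + β * (Δ g) y := by
  ext x
  have h1 := ContDiffAt.laplacian_add (x := x) (f₁ := α • f) (f₂ := β • g)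
    (hf.contDiffAt.const_smul α) (hg.contDiffAt.const_smul β)
  rw [InnerProductSpace.laplacian_smul _ hf.contDiffAt,
    InnerProductSpace.laplacian_smul _ hg.contDiffAt] at h1
  exact h1

theorem iterate_laplacian_linear_combination (m : ℕ) {f g : EuclideanSpace ℝ (Fin n) → ℝ}
    (hf : ContDiff ℝ ∞ f) (hg : ContDiff ℝ ∞ g) (α β : ℝ) :
    Δ^[m] (fun y => α * f y + β * g y) = fun y => α * (Δ^[m] f) y + β * (Δ^[m] g) y := by
  induction m with
  | zero => rfl
  | succ m ih =>
    rw [Function.iterate_succ_apply', Function.iterate_succ_apply', Function.iterate_succ_apply',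
      ih, laplacian_linear_combination
        ((contDiff_infty_iterate_laplacian hf m).of_le two_le_contDiff_infty)
        ((contDiff_infty_iterate_laplacian hg m).of_le two_le_contDiff_infty)]

theorem partialDeriv_comm {f : EuclideanSpace ℝ (Fin n) → ℝ} (hf : ContDiff ℝ 2 f) (i j : Fin n) :
    partialDeriv i (partialDeriv j f) = partialDeriv j (partialDeriv i f) := by
  ext x
  have hd : DifferentiableAt ℝ (fderiv ℝ f) x :=
    ((hf.fderiv_right (m := 1) (by norm_num)).differentiable (by norm_num)) x
  have hs : IsSymmSndFDerivAt ℝ f x := hf.contDiffAt.isSymmSndFDerivAt (by simp)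
  unfold partialDeriv
  rw [fderiv_clm_apply hd (differentiableAt_const _), fderiv_clm_apply hd (differentiableAt_const _)]
  simpa using hs.eq _ _

theorem partialDeriv_sum {ι : Type*} (s : Finset ι) {F : ι → EuclideanSpace ℝ (Fin n) → ℝ}
    (hF : ∀ l ∈ s, Differentiable ℝ (F l)) (i : Fin n) :
    partialDeriv i (∑ l ∈ s, F l) = ∑ l ∈ s, partialDeriv i (F l) := by
  ext x
  simp only [partialDeriv, Finset.sum_apply]
  rw [fderiv_sum fun l hl => (hF l hl) x]
  simp

theorem laplacian_partialDeriv {f : EuclideanSpace ℝ (Fin n) → ℝ} (hf : ContDiff ℝ ∞ f)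
    (i : Fin n) : Δ (partialDeriv i f) = partialDeriv i (Δ f) := by
  rw [laplacian_eq_sum_partialDeriv ((contDiff_infty_partialDeriv hf i).of_le two_le_contDiff_infty),
    laplacian_eq_sum_partialDeriv (hf.of_le two_le_contDiff_infty), partialDeriv_sum]
  · refine Finset.sum_congr rfl fun l _ => ?_
    rw [partialDeriv_comm (hf.of_le two_le_contDiff_infty) l i,
      partialDeriv_comm ((contDiff_infty_partialDeriv hf l).of_le two_le_contDiff_infty) l i]
  · intro l _
    exact (contDiff_infty_partialDeriv (contDiff_infty_partialDeriv hf l) l).differentiable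
      (by simp)

theorem iterate_laplacian_partialDeriv {f : EuclideanSpace ℝ (Fin n) → ℝ} (hf : ContDiff ℝ ∞ f)
    (i : Fin n) (m : ℕ) : Δ^[m] (partialDeriv i f) = partialDeriv i (Δ^[m] f) := by
  induction m with
  | zero => rfl
  | succ m ih =>
    rw [Function.iterate_succ_apply', Function.iterate_succ_apply', ih,
      laplacian_partialDeriv (contDiff_infty_iterate_laplacian hf m)]

theorem hasCompactSupport_partialDeriv {f : EuclideanSpace ℝ (Fin n) → ℝ}
    (hf : HasCompactSupport f) (i : Fin n) : HasCompactSupport (partialDeriv i f) :=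
  hf.fderiv_apply ℝ _

theorem hasCompactSupport_laplacian {f : EuclideanSpace ℝ (Fin n) → ℝ}
    (hf : HasCompactSupport f) : HasCompactSupport (Δ f) := by
  refine hf.mono' fun x hx => ?_
  by_contra hx'
  have h0 : f =ᶠ[𝓝 x] fun _ => 0 := notMem_tsupport_iff_eventuallyEq.1 hx'
  exact hx (by simpa using (InnerProductSpace.laplacian_congr_nhds h0).eq_of_nhds)

theorem hasCompactSupport_iterate_laplacian {f : EuclideanSpace ℝ (Fin n) → ℝ}
    (hf : HasCompactSupport f) (m : ℕ) : HasCompactSupport (Δ^[m] f) := by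
  induction m with
  | zero => exact hf
  | succ m ih => rw [Function.iterate_succ_apply']; exact hasCompactSupport_laplacian ih

theorem integral_partialDeriv_mul {u τ : EuclideanSpace ℝ (Fin n) → ℝ} (hu : ContDiff ℝ 1 u)
    (hτ : ContDiff ℝ 1 τ) (hc : HasCompactSupport τ) (i : Fin n) :
    ∫ x, partialDeriv i u x * τ x = -∫ x, u x * partialDeriv i τ x := by
  have hu' : Continuous (partialDeriv i u) :=
    (contDiff_partialDeriv (N := 0) (by simpa using hu) i).continuous
  have hτ' : Continuous (partialDeriv i τ) :=
    (contDiff_partialDeriv (N := 0) (by simpa using hτ) i).continuous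
  have := integral_mul_fderiv_eq_neg_fderiv_mul_of_integrable (μ := volume) (f := u) (g := τ)
    (v := EuclideanSpace.single i 1)
    ((hu'.mul hτ.continuous).integrable_of_hasCompactSupport hc.mul_left)
    ((hu.continuous.mul hτ').integrable_of_hasCompactSupport
      (hasCompactSupport_partialDeriv hc i).mul_left)
    ((hu.continuous.mul hτ.continuous).integrable_of_hasCompactSupport hc.mul_left)
    (fun x _ => hu.differentiable (by norm_num) x) (fun x _ => hτ.differentiable (by norm_num) x)
  simp only [partialDeriv]
  rw [this, neg_neg]

theorem integral_laplacian_mul {u τ : EuclideanSpace ℝ (Fin n) → ℝ} (hu : ContDiff ℝ 2 u)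
    (hτ : ContDiff ℝ 2 τ) (hc : HasCompactSupport τ) :
    ∫ x, (Δ u) x * τ x = ∫ x, u x * (Δ τ) x := by
  have h2 : (2 : WithTop ℕ∞) = 1 + 1 := by norm_num
  have hu1 (i) : ContDiff ℝ 1 (partialDeriv i u) := contDiff_partialDeriv (h2 ▸ hu) i
  have hτ1 (i) : ContDiff ℝ 1 (partialDeriv i τ) := contDiff_partialDeriv (h2 ▸ hτ) i
  have hu2 (i) : Continuous (partialDeriv i (partialDeriv i u)) :=
    (contDiff_partialDeriv (N := 0) (by simpa using hu1 i) i).continuous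
  have hτ2 (i) : Continuous (partialDeriv i (partialDeriv i τ)) :=
    (contDiff_partialDeriv (N := 0) (by simpa using hτ1 i) i).continuous
  rw [laplacian_eq_sum_partialDeriv hu, laplacian_eq_sum_partialDeriv hτ]
  simp only [Finset.sum_apply, Finset.sum_mul, Finset.mul_sum]
  rw [integral_finsetSum, integral_finsetSum]
  · refine Finset.sum_congr rfl fun i _ => ?_
    rw [integral_partialDeriv_mul (hu1 i) (hτ.of_le (by norm_num)) hc,
      integral_partialDeriv_mul (hu.of_le (by norm_num)) (hτ1 i)
        (hasCompactSupport_partialDeriv hc i), neg_neg]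
  · exact fun i _ => (hu.continuous.mul (hτ2 i)).integrable_of_hasCompactSupport
      (hasCompactSupport_partialDeriv (hasCompactSupport_partialDeriv hc i) i).mul_left
  · exact fun i _ => ((hu2 i).mul hτ.continuous).integrable_of_hasCompactSupport hc.mul_left

theorem integral_iterate_laplacian_mul (m : ℕ) {u τ : EuclideanSpace ℝ (Fin n) → ℝ}
    (hu : ContDiff ℝ ((2 * m : ℕ) : WithTop ℕ∞) u) (hτ : ContDiff ℝ ∞ τ)
    (hc : HasCompactSupport τ) :
    ∫ x, (Δ^[m] u) x * τ x = ∫ x, u x * (Δ^[m] τ) x := by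
  induction m generalizing u with
  | zero => rfl
  | succ m ih =>
    have hu2 : ContDiff ℝ (((2 * m : ℕ) : WithTop ℕ∞) + 2) u := cast_two_mul_succ m ▸ hu
    rw [Function.iterate_succ_apply, Function.iterate_succ_apply', ih (contDiff_laplacian hu2)]
    exact integral_laplacian_mul (hu2.of_le (by simp))
      ((contDiff_infty_iterate_laplacian hτ m).of_le two_le_contDiff_infty)
      (hasCompactSupport_iterate_laplacian hc m)

end LaplacianBasics

/-! ### The regularised kernel: its iterated Laplacian and symbol-type bounds -/

section Bubble

variable {n : ℕ}

/-- A radial function whose gradient at `y` is `(t + |y|²) ^ b • y`. -/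
noncomputable def radialPotential (b t : ℝ) (y : EuclideanSpace ℝ (Fin n)) : ℝ :=
  if b = -1 then Real.log (t + ‖y‖ ^ 2) / 2 else (t + ‖y‖ ^ 2) ^ (b + 1) / (2 * (b + 1))

theorem hasFDerivAt_add_norm_sq (t : ℝ) (y : EuclideanSpace ℝ (Fin n)) :
    HasFDerivAt (fun y : EuclideanSpace ℝ (Fin n) => t + ‖y‖ ^ 2) ((2 : ℝ) • innerSL ℝ y) y := by
  refine (((hasStrictFDerivAt_norm_sq y).hasFDerivAt).const_add t).congr_fderiv ?_
  ext; simp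

theorem hasFDerivAt_rpow_add_norm_sq {t : ℝ} (ht : 0 < t) (b : ℝ)
    (y : EuclideanSpace ℝ (Fin n)) :
    HasFDerivAt (fun y : EuclideanSpace ℝ (Fin n) => (t + ‖y‖ ^ 2) ^ b)
      ((2 * b * (t + ‖y‖ ^ 2) ^ (b - 1)) • innerSL ℝ y) y := by
  have hq : t + ‖y‖ ^ 2 ≠ 0 := by positivity
  refine ((hasFDerivAt_add_norm_sq t y).rpow_const (p := b) (Or.inl hq)).congr_fderiv ?_
  rw [smul_smul]; ring_nf

theorem hasFDerivAt_radialPotential {t : ℝ} (ht : 0 < t) (b : ℝ)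
    (y : EuclideanSpace ℝ (Fin n)) :
    HasFDerivAt (radialPotential b t) (((t + ‖y‖ ^ 2) ^ b) • innerSL ℝ y) y := by
  have hq : t + ‖y‖ ^ 2 ≠ 0 := by positivity
  unfold radialPotential
  by_cases hb : b = -1
  · simp only [hb, if_true]
    simp_rw [div_eq_inv_mul]
    refine (((hasFDerivAt_add_norm_sq t y).log hq).const_mul (2⁻¹ : ℝ)).congr_fderiv ?_
    rw [smul_smul, smul_smul, Real.rpow_neg_one]; congr 1; ring
  · simp only [hb, if_false]
    have hb' : b + 1 ≠ 0 := fun h => hb (by linarith)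
    simp_rw [div_eq_inv_mul]
    refine ((hasFDerivAt_rpow_add_norm_sq ht (b + 1) y).const_mul
      (2 * (b + 1) : ℝ)⁻¹).congr_fderiv ?_
    rw [smul_smul]; congr 1; rw [add_sub_cancel_right]; field_simp

theorem contDiff_rpow_add_norm_sq {t : ℝ} (ht : 0 < t) (b : ℝ) :
    ContDiff ℝ ∞ (fun y : EuclideanSpace ℝ (Fin n) => (t + ‖y‖ ^ 2) ^ b) :=
  (contDiff_const.add (contDiff_norm_sq ℝ)).rpow_const_of_ne fun y => by positivity

theorem contDiff_radialPotential {t : ℝ} (ht : 0 < t) (b : ℝ) :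
    ContDiff ℝ ∞ (radialPotential b t : EuclideanSpace ℝ (Fin n) → ℝ) := by
  unfold radialPotential
  split_ifs
  · exact ((contDiff_const.add (contDiff_norm_sq ℝ)).log fun y => by positivity).div_const _
  · exact (contDiff_rpow_add_norm_sq ht _).div_const _

/-- Writing |y|² = (t + |y|²) - t turns the result into two powers. Only the gradient of `F` enters,
so the power and logarithmic potentials are treated at once. -/
theorem laplacian_of_radial_gradient {t : ℝ} (ht : 0 < t) {F : EuclideanSpace ℝ (Fin n) → ℝ}
    (hF : ContDiff ℝ 2 F) {c b : ℝ}
    (hF' : ∀ y, HasFDerivAt F ((c * (t + ‖y‖ ^ 2) ^ b) • innerSL ℝ y) y) :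
    Δ F = fun y => c * (n + 2 * b) * (t + ‖y‖ ^ 2) ^ b +
      (-2 * c * b * t) * (t + ‖y‖ ^ 2) ^ (b - 1) := by
  have h1 (i : Fin n) : partialDeriv i F = fun y => (c * (t + ‖y‖ ^ 2) ^ b) * y i := by
    ext y
    rw [partialDeriv, (hF' y).fderiv]
    simp [EuclideanSpace.inner_single_right]
  have h2 (i : Fin n) : partialDeriv i (partialDeriv i F) = fun y =>
      c * (t + ‖y‖ ^ 2) ^ b + c * (2 * b * (t + ‖y‖ ^ 2) ^ (b - 1)) * (y i) ^ 2 := by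
    ext y
    rw [h1]
    have hp : HasFDerivAt (fun y : EuclideanSpace ℝ (Fin n) => y i)
      (EuclideanSpace.proj i : EuclideanSpace ℝ (Fin n) →L[ℝ] ℝ) y :=
      (EuclideanSpace.proj i : EuclideanSpace ℝ (Fin n) →L[ℝ] ℝ).hasFDerivAt
    have hm := ((hasFDerivAt_rpow_add_norm_sq ht b y).const_mul c).mul hp
    rw [partialDeriv]
    erw [hm.fderiv]
    simp [EuclideanSpace.inner_single_right]
    ring
  rw [laplacian_eq_sum_partialDeriv hF]
  ext y
  have hq : 0 < t + ‖y‖ ^ 2 := by positivity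
  have hs : ∑ i, y i ^ 2 = ‖y‖ ^ 2 := by rw [EuclideanSpace.real_norm_sq_eq]
  have hr : (t + ‖y‖ ^ 2) ^ b = (t + ‖y‖ ^ 2) ^ (b - 1) * (t + ‖y‖ ^ 2) := by
    rw [← Real.rpow_add_one hq.ne', sub_add_cancel]
  rw [Finset.sum_apply]
  simp only [h2]
  rw [Finset.sum_add_distrib, ← Finset.mul_sum, ← Finset.mul_sum, hs, Finset.sum_const, Finset.card_univ,
    Fintype.card_fin, nsmul_eq_mul, hr]
  ring

/-- The constant in `Δ^k (t + |y|²)^(k - n/2) = c t^k (t + |y|²)^(-k - n/2)`. -/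
noncomputable def bubbleConst (n : ℕ) (k : ℕ) : ℝ :=
  ∏ j ∈ Finset.range k, 4 * (((j : ℝ) + 1) - n / 2) * ((j : ℝ) + n / 2)

theorem bubbleConst_succ (n k : ℕ) :
    bubbleConst n (k + 1) = bubbleConst n k * (4 * ((k + 1) - n / 2) * (k + n / 2)) := by
  rw [bubbleConst, Finset.prod_range_succ, ← bubbleConst]

/-- The two claims are proved by a joint induction: the gradient of the (k+1)-st power has the form
required by the second claim at k. Phrasing that claim through a gradient avoids dividing by k + 1 -
n/2, which may be zero. -/
theorem iterate_laplacian_bubble {t : ℝ} (ht : 0 < t) (k : ℕ) :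
    (Δ^[k] (fun y : EuclideanSpace ℝ (Fin n) => (t + ‖y‖ ^ 2) ^ ((k : ℝ) - n / 2)) =
      fun y => bubbleConst n k * t ^ k * (t + ‖y‖ ^ 2) ^ (-(k : ℝ) - n / 2)) ∧
    ∀ (F : EuclideanSpace ℝ (Fin n) → ℝ) (c : ℝ), ContDiff ℝ 2 F →
      (∀ y, HasFDerivAt F ((c * (t + ‖y‖ ^ 2) ^ ((k : ℝ) - n / 2)) • innerSL ℝ y) y) →
      Δ^[k + 1] F = fun y => c * (2 * (k + n / 2) * bubbleConst n k) * t ^ (k + 1) *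
        (t + ‖y‖ ^ 2) ^ (-(k : ℝ) - 1 - n / 2) := by
  induction k with
  | zero =>
    refine ⟨?_, fun F c hF hF' => ?_⟩
    · ext y; simp [bubbleConst]
    · rw [zero_add, Function.iterate_one, laplacian_of_radial_gradient ht hF hF']
      ext y
      simp only [bubbleConst, Finset.range_zero, Finset.prod_empty, Nat.cast_zero]
      rw [show (0 : ℝ) - n / 2 - 1 = -0 - 1 - n / 2 by ring]
      ring
  | succ k ih =>
    have hA : Δ^[k + 1] (fun y : EuclideanSpace ℝ (Fin n) =>
        (t + ‖y‖ ^ 2) ^ (((k + 1 : ℕ) : ℝ) - n / 2)) =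
        fun y => bubbleConst n (k + 1) * t ^ (k + 1) *
          (t + ‖y‖ ^ 2) ^ (-((k + 1 : ℕ) : ℝ) - n / 2) := by
      rw [ih.2 _ (2 * (((k + 1 : ℕ) : ℝ) - n / 2))
        ((contDiff_rpow_add_norm_sq ht _).of_le two_le_contDiff_infty)]
      · ext y
        rw [bubbleConst_succ]
        push_cast
        rw [show (-(k : ℝ) - 1 - n / 2) = -((k : ℝ) + 1) - n / 2 by ring]
        ring
      · intro y
        refine (hasFDerivAt_rpow_add_norm_sq ht (((k + 1 : ℕ) : ℝ) - n / 2) y).congr_fderiv ?_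
        rw [show ((k + 1 : ℕ) : ℝ) - n / 2 - 1 = (k : ℝ) - n / 2 by push_cast; ring]
    refine ⟨hA, fun F c hF hF' => ?_⟩
    -- One Laplacian beyond `ih.1`. The first of its two powers cancels the contribution of `hA`,
    -- leaving a single power of t + |y|².
    have hB : Δ^[k + 1] (fun y : EuclideanSpace ℝ (Fin n) =>
        (t + ‖y‖ ^ 2) ^ ((((k + 1 : ℕ) : ℝ) - n / 2) - 1)) = fun y =>
        bubbleConst n k * t ^ k * (2 * (-(k : ℝ) - n / 2) *
          ((-2 * (k + 1)) * (t + ‖y‖ ^ 2) ^ (-(k : ℝ) - 1 - n / 2) +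
           2 * (k + 1 + n / 2) * t * (t + ‖y‖ ^ 2) ^ (-((k + 1 : ℕ) : ℝ) - 1 - n / 2))) := by
      rw [show (((k + 1 : ℕ) : ℝ) - n / 2) - 1 = (k : ℝ) - n / 2 by push_cast; ring,
        Function.iterate_succ_apply', ih.1,
        laplacian_of_radial_gradient ht (c := bubbleConst n k * t ^ k * (2 * (-(k : ℝ) - n / 2)))
          (b := -(k : ℝ) - 1 - n / 2)]
      · ext y
        rw [show -(k : ℝ) - 1 - n / 2 - 1 = -((k + 1 : ℕ) : ℝ) - 1 - n / 2 by push_cast; ring]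
        push_cast; ring
      · exact contDiff_const.mul ((contDiff_rpow_add_norm_sq ht _).of_le two_le_contDiff_infty)
      · intro y
        refine ((hasFDerivAt_rpow_add_norm_sq ht (-(k : ℝ) - n / 2) y).const_mul
          (bubbleConst n k * t ^ k)).congr_fderiv ?_
        rw [smul_smul, show -(k : ℝ) - 1 - n / 2 = -(k : ℝ) - n / 2 - 1 by ring]
        congr 1; ring
    rw [Function.iterate_succ_apply, laplacian_of_radial_gradient ht hF hF',
      iterate_laplacian_linear_combination _ (contDiff_rpow_add_norm_sq ht _)
        (contDiff_rpow_add_norm_sq ht _), hA, hB]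
    ext y
    rw [bubbleConst_succ, show -(k : ℝ) - 1 - n / 2 = -((k + 1 : ℕ) : ℝ) - n / 2 by push_cast; ring]
    push_cast
    ring

theorem iterate_laplacian_radialPotential {t : ℝ} (ht : 0 < t) (k : ℕ) :
    Δ^[k + 1] (radialPotential ((k : ℝ) - n / 2) t : EuclideanSpace ℝ (Fin n) → ℝ) =
      fun y => (2 * (k + n / 2) * bubbleConst n k) * t ^ (k + 1) *
        (t + ‖y‖ ^ 2) ^ (-(k : ℝ) - 1 - n / 2) := by
  have := (iterate_laplacian_bubble (n := n) ht k).2 (radialPotential ((k : ℝ) - n / 2) t) 1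
    ((contDiff_radialPotential ht _).of_le two_le_contDiff_infty)
    (fun y => by rw [one_mul]; exact hasFDerivAt_radialPotential ht _ y)
  simpa using this

theorem innerSL_iteratedFDeriv_bound (N : ℕ) {t : ℝ} (ht : 0 < t)
    (y : EuclideanSpace ℝ (Fin n)) :
    ‖iteratedFDeriv ℝ N (fun y : EuclideanSpace ℝ (Fin n) => innerSL ℝ y) y‖ ≤
      √(t + ‖y‖ ^ 2) ^ (1 - (N : ℝ)) := by
  have hq : 0 < t + ‖y‖ ^ 2 := by positivity
  match N with
  | 0 =>
    simp only [norm_iteratedFDeriv_zero, Nat.cast_zero, sub_zero, Real.rpow_one,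
      innerSL_apply_norm]
    exact Real.le_sqrt_of_sq_le (by linarith)
  | 1 =>
    rw [← norm_iteratedFDeriv_fderiv, norm_iteratedFDeriv_zero,
      ContinuousLinearMap.fderiv (innerSL ℝ : EuclideanSpace ℝ (Fin n) →L[ℝ] _)]
    simpa using norm_innerSL_le (E := EuclideanSpace ℝ (Fin n)) ℝ
  | N + 2 =>
    have : iteratedFDeriv ℝ (N + 2) (fun y : EuclideanSpace ℝ (Fin n) => innerSL ℝ y) y = 0 := by
      rw [← norm_eq_zero, ← norm_iteratedFDeriv_fderiv]
      have : fderiv ℝ (fun y : EuclideanSpace ℝ (Fin n) => innerSL ℝ y) = fun _ => innerSL ℝ := by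
        ext1 y; exact ContinuousLinearMap.fderiv _
      rw [this, iteratedFDeriv_const_of_ne (by omega)]
      simp
    rw [this, norm_zero]
    positivity

theorem contDiff_rpow_smul_innerSL {t : ℝ} (ht : 0 < t) (b : ℝ) :
    ContDiff ℝ ∞ (fun y : EuclideanSpace ℝ (Fin n) => (t + ‖y‖ ^ 2) ^ b • innerSL ℝ y) :=
  (contDiff_rpow_add_norm_sq ht b).smul (innerSL ℝ).contDiff

/-- Leibniz rule, with √(t + |y|²) as the common scale: `innerSL` behaves like a symbol of degree 1.
This is the inductive step for `rpow_add_norm_sq_bound`, whose derivative is again of this product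
form with b lowered by 1. The constant must not depend on t. -/
theorem rpow_smul_innerSL_bound_of (N : ℕ) (b : ℝ)
    (h : ∀ i ≤ N, ∃ C, 0 ≤ C ∧ ∀ t > 0, ∀ y : EuclideanSpace ℝ (Fin n),
      ‖iteratedFDeriv ℝ i (fun y : EuclideanSpace ℝ (Fin n) => (t + ‖y‖ ^ 2) ^ b) y‖ ≤
        C * √(t + ‖y‖ ^ 2) ^ (2 * b - i)) :
    ∃ C, 0 ≤ C ∧ ∀ t > 0, ∀ y : EuclideanSpace ℝ (Fin n),
      ‖iteratedFDeriv ℝ N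
        (fun y : EuclideanSpace ℝ (Fin n) => (t + ‖y‖ ^ 2) ^ b • innerSL ℝ y) y‖ ≤
        C * √(t + ‖y‖ ^ 2) ^ (2 * b + 1 - N) := by
  choose! C hC0 hC using h
  refine ⟨∑ i ∈ Finset.range (N + 1), N.choose i * C i,
    Finset.sum_nonneg fun i hi =>
      mul_nonneg (by positivity) (hC0 i (by simpa [Nat.lt_succ_iff] using hi)), fun t ht y => ?_⟩
  have hw : 0 < √(t + ‖y‖ ^ 2) := by positivity
  refine (norm_iteratedFDeriv_smul_le (contDiff_rpow_add_norm_sq ht b)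
    (innerSL ℝ).contDiff y (n := N) (by exact_mod_cast le_top)).trans ?_
  rw [Finset.sum_mul]
  refine Finset.sum_le_sum fun i hi => ?_
  have hi' : i ≤ N := by simpa [Nat.lt_succ_iff] using hi
  have e : √(t + ‖y‖ ^ 2) ^ (2 * b + 1 - N) =
      √(t + ‖y‖ ^ 2) ^ (2 * b - i) * √(t + ‖y‖ ^ 2) ^ (1 - ((N - i : ℕ) : ℝ)) := by
    rw [← Real.rpow_add hw, Nat.cast_sub hi']; congr 1; ring
  rw [e, ← mul_assoc, mul_assoc _ (C i)]
  have h0 := hC0 i hi'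
  gcongr
  · exact hC i hi' t ht y
  · exact innerSL_iteratedFDeriv_bound (N - i) ht y

theorem rpow_add_norm_sq_bound (N : ℕ) : ∀ b : ℝ,
    ∃ C, 0 ≤ C ∧ ∀ t > 0, ∀ y : EuclideanSpace ℝ (Fin n),
      ‖iteratedFDeriv ℝ N (fun y : EuclideanSpace ℝ (Fin n) => (t + ‖y‖ ^ 2) ^ b) y‖ ≤
        C * √(t + ‖y‖ ^ 2) ^ (2 * b - N) := by
  induction N using Nat.strong_induction_on with
  | _ N ih =>
    intro b
    match N with
    | 0 =>
      refine ⟨1, zero_le_one, fun t ht y => ?_⟩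
      have hq : 0 < t + ‖y‖ ^ 2 := by positivity
      rw [norm_iteratedFDeriv_zero, one_mul, Nat.cast_zero, sub_zero, mul_comm,
        Real.rpow_mul (by positivity), Real.norm_of_nonneg (by positivity),
        ← Real.rpow_mul (by positivity), mul_comm, Real.rpow_mul (by positivity), Real.rpow_two,
        Real.sq_sqrt hq.le]
    | N + 1 =>
      obtain ⟨C, hC0, hC⟩ := rpow_smul_innerSL_bound_of (n := n) N (b - 1)
        fun i hi => ih i (by omega) (b - 1)
      refine ⟨|2 * b| * C, by positivity, fun t ht y => ?_⟩
      have e : fderiv ℝ (fun y : EuclideanSpace ℝ (Fin n) => (t + ‖y‖ ^ 2) ^ b) =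
          fun y => (2 * b) • ((t + ‖y‖ ^ 2) ^ (b - 1) • innerSL ℝ y) := by
        ext1 y
        rw [(hasFDerivAt_rpow_add_norm_sq ht b y).fderiv, smul_smul]
      rw [← norm_iteratedFDeriv_fderiv, e, iteratedFDeriv_const_smul_apply'
        ((contDiff_rpow_smul_innerSL ht _).of_le (by exact_mod_cast le_top)).contDiffAt,
        norm_smul, Real.norm_eq_abs, mul_assoc]
      gcongr
      rw [show 2 * b - ((N + 1 : ℕ) : ℝ) = 2 * (b - 1) + 1 - N by push_cast; ring]
      exact hC t ht y

theorem radialPotential_bound (N : ℕ) (b : ℝ) :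
    ∃ C, 0 ≤ C ∧ ∀ t > 0, ∀ y : EuclideanSpace ℝ (Fin n),
      ‖iteratedFDeriv ℝ (N + 1) (radialPotential b t) y‖ ≤
        C * √(t + ‖y‖ ^ 2) ^ (2 * b + 1 - N) := by
  obtain ⟨C, hC0, hC⟩ := rpow_smul_innerSL_bound_of (n := n) N b
    fun i _ => rpow_add_norm_sq_bound i b
  refine ⟨C, hC0, fun t ht y => ?_⟩
  rw [← norm_iteratedFDeriv_fderiv]
  rw [show fderiv ℝ (radialPotential b t) = _ from
    funext fun y => (hasFDerivAt_radialPotential (n := n) ht b y).fderiv]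
  exact hC t ht y

end Bubble

/-! ### Green's identity against slowly decaying kernels -/

section Duality

variable {n : ℕ}

theorem natCast_le_contDiff_infty (N : ℕ) : (N : WithTop ℕ∞) ≤ ∞ := by
  exact_mod_cast le_top

theorem norm_iteratedFDeriv_partialDeriv_le (N : ℕ) {f : EuclideanSpace ℝ (Fin n) → ℝ}
    (hf : ContDiff ℝ ∞ f) (i : Fin n) (x : EuclideanSpace ℝ (Fin n)) :
    ‖iteratedFDeriv ℝ N (partialDeriv i f) x‖ ≤ ‖iteratedFDeriv ℝ (N + 1) f x‖ := by
  rw [← norm_iteratedFDeriv_fderiv]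
  refine (norm_iteratedFDeriv_clm_apply_const (f := fderiv ℝ f) (c := EuclideanSpace.single i 1)
    ((hf.fderiv_right (m := ∞) le_rfl).contDiffAt)
    (by exact_mod_cast le_top : (N : WithTop ℕ∞) ≤ ∞)).trans ?_
  simp

theorem norm_iteratedFDeriv_laplacian_le (N : ℕ) {f : EuclideanSpace ℝ (Fin n) → ℝ}
    (hf : ContDiff ℝ ∞ f) (x : EuclideanSpace ℝ (Fin n)) :
    ‖iteratedFDeriv ℝ N (Δ f) x‖ ≤ n * ‖iteratedFDeriv ℝ (N + 2) f x‖ := by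
  have h (i : Fin n) := contDiff_infty_partialDeriv (contDiff_infty_partialDeriv hf i) i
  have e : Δ f = fun x => ∑ i, partialDeriv i (partialDeriv i f) x := by
    rw [laplacian_eq_sum_partialDeriv (hf.of_le two_le_contDiff_infty)]
    ext; simp
  rw [e, iteratedFDeriv_fun_sum_apply fun i _ =>
    ((h i).of_le (natCast_le_contDiff_infty N)).contDiffAt]
  refine (norm_sum_le _ _).trans ?_
  refine (Finset.sum_le_card_nsmul _ _ ‖iteratedFDeriv ℝ (N + 2) f x‖ fun i _ => ?_).trans ?_
  · exact (norm_iteratedFDeriv_partialDeriv_le N (contDiff_infty_partialDeriv hf i) i x).trans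
      (norm_iteratedFDeriv_partialDeriv_le (N + 1) hf i x)
  · simp

theorem norm_iterate_laplacian_le (m : ℕ) {f : EuclideanSpace ℝ (Fin n) → ℝ}
    (hf : ContDiff ℝ ∞ f) (x : EuclideanSpace ℝ (Fin n)) :
    ‖(Δ^[m] f) x‖ ≤ (n : ℝ) ^ m * ‖iteratedFDeriv ℝ (2 * m) f x‖ := by
  suffices ∀ N M, M = N + 2 * m → ‖iteratedFDeriv ℝ N (Δ^[m] f) x‖ ≤
      (n : ℝ) ^ m * ‖iteratedFDeriv ℝ M f x‖ by
    simpa only [norm_iteratedFDeriv_zero] using this 0 (2 * m) (by simp)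
  induction m with
  | zero => rintro N M rfl; simp
  | succ m ih =>
    rintro N M hM
    rw [Function.iterate_succ_apply']
    refine (norm_iteratedFDeriv_laplacian_le N (contDiff_infty_iterate_laplacian hf m) x).trans ?_
    rw [pow_succ', mul_assoc]
    gcongr
    exact ih (N + 2) M (by omega)

/-- The mean value inequality for the N-th derivative trades the difference for one more derivative,
hence one more power of decay. The constant may depend on t, x and x' because it only serves to
justify Green's identity. -/
theorem radialPotential_sub_bound {b t : ℝ} (hb : 2 * b + 1 ≤ 0) (ht : 0 < t)
    (x x' : EuclideanSpace ℝ (Fin n)) (N : ℕ) :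
    ∃ C, 0 ≤ C ∧ ∀ y, ‖iteratedFDeriv ℝ N
      (fun y => radialPotential b t (y - x) - radialPotential b t (y - x')) y‖ ≤
        C * (1 + ‖y‖) ^ (2 * b + 1 - N) := by
  obtain ⟨C, hC0, hC⟩ := radialPotential_bound (n := n) N b
  set X := max ‖x‖ ‖x'‖ with hX
  have hX0 : 0 ≤ X := le_max_of_le_left (norm_nonneg _)
  -- Chosen so that 1 + |y| ≤ A √(t + |z|²) whenever |z - y| ≤ X; the ball contains both y - x and y
  -- - x'.
  set A := (1 + X) / √t + 1 with hA
  have hst : 0 < √t := Real.sqrt_pos.2 ht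
  have hA0 : 0 < A := by positivity
  have he : 2 * b + 1 - N ≤ 0 := by have : (0 : ℝ) ≤ N := by positivity
                                    linarith
  have hΦ : ContDiff ℝ ∞ (radialPotential b t : EuclideanSpace ℝ (Fin n) → ℝ) :=
    contDiff_radialPotential ht b
  refine ⟨C * (A⁻¹) ^ (2 * b + 1 - N) * ‖x' - x‖, by positivity, fun y => ?_⟩
  have hsub (z : EuclideanSpace ℝ (Fin n)) :
      ContDiffAt ℝ N (fun y => radialPotential b t (y - z)) y :=
    ((hΦ.comp (contDiff_id.sub contDiff_const)).of_le (by exact_mod_cast le_top)).contDiffAt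
  have hfun : (fun y => radialPotential b t (y - x) - radialPotential b t (y - x')) =
    (fun y => radialPotential b t (y - x)) - fun y => radialPotential b t (y - x') := rfl
  rw [hfun, iteratedFDeriv_sub_apply (hsub x) (hsub x'), iteratedFDeriv_comp_sub,
    iteratedFDeriv_comp_sub]
  have hbound : ∀ z ∈ Metric.closedBall y X,
      ‖fderiv ℝ (iteratedFDeriv ℝ N (radialPotential b t)) z‖ ≤
        C * ((A⁻¹) ^ (2 * b + 1 - N) * (1 + ‖y‖) ^ (2 * b + 1 - N)) := by
    intro z hz
    rw [norm_fderiv_iteratedFDeriv]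
    refine (hC t ht z).trans ?_
    gcongr
    rw [← Real.mul_rpow (by positivity) (by positivity)]
    refine Real.rpow_le_rpow_of_nonpos (by positivity) ?_ he
    rw [inv_mul_le_iff₀ hA0, hA, add_mul, one_mul, div_mul_eq_mul_div]
    have h1 : √t ≤ √(t + ‖z‖ ^ 2) := Real.sqrt_le_sqrt (by nlinarith [sq_nonneg ‖z‖])
    have h2 : ‖z‖ ≤ √(t + ‖z‖ ^ 2) := Real.le_sqrt_of_sq_le (by linarith)
    have h3 : 1 + X ≤ (1 + X) * √(t + ‖z‖ ^ 2) / √t := by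
      rw [le_div_iff₀ hst]; gcongr
    have h4 : ‖y‖ ≤ ‖z‖ + X := by
      have := norm_le_norm_add_norm_sub' y z
      rw [mem_closedBall_iff_norm'] at hz
      linarith
    linarith
  have hm := (convex_closedBall y X).norm_image_sub_le_of_norm_fderiv_le
    (f := iteratedFDeriv ℝ N (radialPotential b t))
    (fun z _ => (hΦ.differentiable_iteratedFDeriv (by exact_mod_cast ENat.natCast_lt_top N)) z) hbound
    (x := y - x') (y := y - x) (by simp [hX]) (by simp [hX])
  refine hm.trans (le_of_eq ?_)
  rw [show y - x - (y - x') = x' - x by abel]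
  ring

/-- Each derivative costs R⁻¹, and on the support 1 + |y| ≤ 3R; the bound is therefore uniform in R.
-/
theorem scaled_cutoff_bound {ψ : EuclideanSpace ℝ (Fin n) → ℝ} (hψ : ContDiff ℝ ∞ ψ)
    (hsupp : ∀ y, 2 < ‖y‖ → ψ y = 0) (N : ℕ) :
    ∃ C, 0 ≤ C ∧ ∀ R ≥ (1 : ℝ), ∀ y, ‖iteratedFDeriv ℝ N (fun y => ψ (R⁻¹ • y)) y‖ ≤
      C * (1 + ‖y‖) ^ (-(N : ℝ)) := by
  have hts : tsupport ψ ⊆ Metric.closedBall 0 2 := by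
    refine closure_minimal (fun y hy => ?_) Metric.isClosed_closedBall
    rw [mem_closedBall_zero_iff]
    by_contra h
    exact hy (hsupp y (not_le.1 h))
  have hc : HasCompactSupport ψ := HasCompactSupport.of_support_subset_isCompact
    (isCompact_closedBall 0 2) ((subset_tsupport ψ).trans hts)
  obtain ⟨M, hM⟩ := (hc.iteratedFDeriv N).exists_bound_of_continuous
    (hψ.continuous_iteratedFDeriv (m := N) (by exact_mod_cast le_top))
  have hM0 : 0 ≤ M := (norm_nonneg _).trans (hM 0)
  refine ⟨M * 3 ^ N, by positivity, fun R hR y => ?_⟩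
  have hR0 : 0 < R := by linarith
  rw [iteratedFDeriv_comp_const_smul (i := N) _ (hψ.of_le (by exact_mod_cast le_top))]
  simp only [norm_smul, norm_pow, norm_inv, Real.norm_of_nonneg hR0.le]
  by_cases hy : ‖y‖ ≤ 2 * R
  · have h1 : (R⁻¹) ^ N ≤ 3 ^ N * (1 + ‖y‖) ^ (-(N : ℝ)) := by
      rw [Real.rpow_neg (by positivity), Real.rpow_natCast, ← inv_pow, ← mul_pow]
      refine pow_le_pow_left₀ (by positivity) ?_ N
      rw [← div_eq_mul_inv, inv_le_comm₀ hR0 (by positivity), inv_div, div_le_iff₀ (by norm_num)]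
      linarith
    calc _ ≤ (3 ^ N * (1 + ‖y‖) ^ (-(N : ℝ))) * M := by
          gcongr
          exact hM _
      _ = _ := by ring
  · have : iteratedFDeriv ℝ N ψ (R⁻¹ • y) = 0 := by
      by_contra h
      have := hts (support_iteratedFDeriv_subset N h)
      rw [mem_closedBall_zero_iff, norm_smul, norm_inv, Real.norm_of_nonneg hR0.le,
        inv_mul_le_iff₀ hR0] at this
      exact hy (by linarith)
    rw [this, norm_zero, mul_zero]
    positivity

/-- Multiply `G` by expanding cutoffs. The left side is eventually stationary since Δ^m u has
compact support; the right side converges by dominated convergence, the majorant having exponent (1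
- ε) + (-n - 1) = -(n + ε). -/
theorem integral_iterate_laplacian_mul_of_decay {m : ℕ} {ε d : ℝ} (hε : 0 < ε)
    {u G : EuclideanSpace ℝ (Fin n) → ℝ} (hu : ContDiff ℝ ((2 * m : ℕ) : WithTop ℕ∞) u)
    {B : ℝ} (hub : ∀ y, |u y| ≤ B * (1 + ‖y‖) ^ (1 - ε)) (hf : HasCompactSupport (Δ^[m] u))
    (hG : ContDiff ℝ ∞ G)
    (hGb : ∀ N : ℕ, ∃ C, 0 ≤ C ∧ ∀ y, ‖iteratedFDeriv ℝ N G y‖ ≤ C * (1 + ‖y‖) ^ (d - N))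
    (hd : d - 2 * m ≤ -(n : ℝ) - 1) :
    ∫ y, (Δ^[m] u) y * G y = ∫ y, u y * (Δ^[m] G) y := by
  have hB0 : 0 ≤ B := by
    have := (abs_nonneg _).trans (hub 0)
    simpa using this
  let ψ : ContDiffBump (0 : EuclideanSpace ℝ (Fin n)) := ⟨1, 2, by norm_num, by norm_num⟩
  have hψ : ContDiff ℝ ∞ ψ := ψ.contDiff
  have hψs : ∀ y, 2 < ‖y‖ → ψ y = 0 := fun y hy =>
    ψ.zero_of_le_dist (by simpa [ψ] using hy.le)
  have hψ1 : ∀ y, ‖y‖ ≤ 1 → ψ y = 1 := fun y hy =>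
    ψ.one_of_mem_closedBall (by simpa [ψ] using hy)
  let τ : ℕ → EuclideanSpace ℝ (Fin n) → ℝ := fun j y => ψ (((j : ℝ) + 1)⁻¹ • y) * G y
  have hψj (j : ℕ) : ContDiff ℝ ∞ fun y => ψ (((j : ℝ) + 1)⁻¹ • y) :=
    hψ.comp (contDiff_const_smul _)
  have hτ (j : ℕ) : ContDiff ℝ ∞ (τ j) := (hψj j).mul hG
  have hτc (j : ℕ) : HasCompactSupport (τ j) := by
    have : HasCompactSupport fun y => ψ (((j : ℝ) + 1)⁻¹ • y) :=
      ψ.hasCompactSupport.comp_smul (by positivity)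
    exact this.mul_right
  have hτG (R : ℝ) : ∀ᶠ j : ℕ in atTop, ∀ y, ‖y‖ < R → τ j =ᶠ[𝓝 y] G := by
    filter_upwards [tendsto_natCast_atTop_atTop.eventually_ge_atTop R] with j hj y hy
    have : ∀ᶠ z in 𝓝 y, ‖z‖ < R := (continuous_norm.tendsto y).eventually_lt_const hy
    filter_upwards [this] with z hz
    have : ψ (((j : ℝ) + 1)⁻¹ • z) = 1 := hψ1 _ (by
      rw [norm_smul, norm_inv, Real.norm_of_nonneg (by positivity), inv_mul_le_iff₀ (by positivity)]
      linarith)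
    simp only [τ, this, one_mul]
  have hid (j : ℕ) := integral_iterate_laplacian_mul m hu (hτ j) (hτc j)
  have hleft : ∀ᶠ j : ℕ in atTop,
      ∫ y, (Δ^[m] u) y * τ j y = ∫ y, (Δ^[m] u) y * G y := by
    obtain ⟨R, hR⟩ := hf.isCompact.isBounded.subset_ball (0 : EuclideanSpace ℝ (Fin n))
    filter_upwards [hτG R] with j hj
    congr 1
    ext y
    by_cases hy : y ∈ tsupport (Δ^[m] u)
    · rw [(hj y (by simpa using hR hy)).eq_of_nhds]
    · rw [image_eq_zero_of_notMem_tsupport hy, zero_mul, zero_mul]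
  -- In every Leibniz term the derivatives falling on the cutoff decay as well as those falling on
  -- `G`, so all terms have total order d - 2m.
  have hbound : ∃ K, 0 ≤ K ∧ ∀ j : ℕ, ∀ y,
      ‖(Δ^[m] (τ j)) y‖ ≤ K * (1 + ‖y‖) ^ (-(n : ℝ) - 1) := by
    choose Cψ hCψ0 hCψ using scaled_cutoff_bound hψ hψs
    choose CG hCG0 hCG using hGb
    refine ⟨(n : ℝ) ^ m * ∑ i ∈ Finset.range (2 * m + 1),
      ((2 * m).choose i) * (Cψ i * CG (2 * m - i)), ?_, fun j y => ?_⟩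
    · exact mul_nonneg (by positivity) (Finset.sum_nonneg fun i _ =>
        mul_nonneg (by positivity) (mul_nonneg (hCψ0 i) (hCG0 _)))
    refine (norm_iterate_laplacian_le m (hτ j) y).trans ?_
    rw [mul_assoc, Finset.sum_mul]
    gcongr
    refine (norm_iteratedFDeriv_mul_le (hψj j) hG y (n := 2 * m)
      (natCast_le_contDiff_infty _)).trans ?_
    refine Finset.sum_le_sum fun i hi => ?_
    have hi' : i ≤ 2 * m := by simpa [Nat.lt_succ_iff] using hi
    have h1 := hCψ i (j + 1) (by simp) y
    have h2 := hCG (2 * m - i) y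
    have h3 : (1 + ‖y‖) ^ (-(i : ℝ)) * (1 + ‖y‖) ^ (d - ((2 * m - i : ℕ) : ℝ)) ≤
        (1 + ‖y‖) ^ (-(n : ℝ) - 1) := by
      rw [← Real.rpow_add (by positivity)]
      refine Real.rpow_le_rpow_of_exponent_le (by simp) ?_
      rw [Nat.cast_sub hi']
      push_cast
      linarith
    have h0 := hCψ0 i
    have h0' := hCG0 (2 * m - i)
    calc _ ≤ ((2 * m).choose i : ℝ) * (Cψ i * (1 + ‖y‖) ^ (-(i : ℝ))) *
          (CG (2 * m - i) * (1 + ‖y‖) ^ (d - ((2 * m - i : ℕ) : ℝ))) := by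
          gcongr
      _ = ((2 * m).choose i : ℝ) * (Cψ i * CG (2 * m - i)) *
          ((1 + ‖y‖) ^ (-(i : ℝ)) * (1 + ‖y‖) ^ (d - ((2 * m - i : ℕ) : ℝ))) := by ring
      _ ≤ _ := by gcongr
  obtain ⟨K, hK0, hK⟩ := hbound
  have hright : Tendsto (fun j => ∫ y, u y * (Δ^[m] (τ j)) y) atTop
      (𝓝 (∫ y, u y * (Δ^[m] G) y)) := by
    refine tendsto_integral_of_dominated_convergence
      (fun y => (B * K) * (1 + ‖y‖) ^ (-((n : ℝ) + ε))) ?_ ?_ ?_ ?_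
    · exact fun j => (hu.continuous.mul
        (contDiff_infty_iterate_laplacian (hτ j) m).continuous).aestronglyMeasurable
    · refine Integrable.const_mul (integrable_one_add_norm ?_) _
      simpa using hε
    · refine fun j => Eventually.of_forall fun y => ?_
      rw [norm_mul, Real.norm_eq_abs]
      calc _ ≤ (B * (1 + ‖y‖) ^ (1 - ε)) * (K * (1 + ‖y‖) ^ (-(n : ℝ) - 1)) := by
            gcongr
            · exact hub y
            · exact hK j y
        _ = (B * K) * ((1 + ‖y‖) ^ (1 - ε) * (1 + ‖y‖) ^ (-(n : ℝ) - 1)) := by ring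
        _ = _ := by
            rw [← Real.rpow_add (by positivity)]
            congr 2
            ring
    · refine Eventually.of_forall fun y => tendsto_const_nhds.mul ?_
      refine tendsto_const_nhds.congr' ?_
      filter_upwards [hτG (‖y‖ + 1)] with j hj
      exact (iterate_laplacian_congr_nhds (hj y (by linarith)) m).eq_of_nhds.symm
  refine tendsto_nhds_unique ?_ hright
  refine tendsto_const_nhds.congr' ?_
  filter_upwards [hleft] with j hj
  rw [← hj, hid j]

end Duality

/-! ### The approximate identity -/

section Mollification

variable {n : ℕ}

theorem integrable_mul_rpow_one_add_norm_sq {p : ℝ} (hp : (n : ℝ) + 1 < 2 * p)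
    {u : EuclideanSpace ℝ (Fin n) → ℝ} (hu : Continuous u) {A : ℝ}
    (hA : ∀ z, |u z| ≤ A * (1 + ‖z‖)) :
    Integrable fun z => u z * (1 + ‖z‖ ^ 2) ^ (-p) := by
  have hA0 : 0 ≤ A := by simpa using (abs_nonneg _).trans (hA 0)
  have hint : Integrable fun z : EuclideanSpace ℝ (Fin n) =>
      (A * 2 ^ p) * (1 + ‖z‖) ^ (-(2 * p - 1)) := by
    refine (integrable_one_add_norm ?_).const_mul _
    simp; linarith
  refine hint.mono' ?_ (Eventually.of_forall fun z => ?_)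
  · exact (hu.mul (contDiff_rpow_add_norm_sq one_pos _).continuous).aestronglyMeasurable
  · have h1 := rpow_neg_one_add_norm_sq_le (r := 2 * p) z (by linarith [(Nat.cast_nonneg n : (0 : ℝ) ≤ n)])
    rw [show -(2 * p) / 2 = -p by ring, show 2 * p / 2 = p by ring] at h1
    rw [norm_mul, Real.norm_eq_abs, Real.norm_of_nonneg (by positivity)]
    calc _ ≤ (A * (1 + ‖z‖)) * (2 ^ p * (1 + ‖z‖) ^ (-(2 * p))) := by
          gcongr
          exact hA z
      _ = A * 2 ^ p * ((1 + ‖z‖) ^ (-(2 * p)) * (1 + ‖z‖)) := by ring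
      _ = _ := by
          rw [← Real.rpow_add_one (by positivity)]
          congr 2; ring

theorem linear_growth_comp {u : EuclideanSpace ℝ (Fin n) → ℝ} {B : ℝ}
    (hB : ∀ z, |u z| ≤ B * (1 + ‖z‖)) (x : EuclideanSpace ℝ (Fin n)) {s : ℝ} (hs : 0 ≤ s)
    (hs1 : s ≤ 1) (z : EuclideanSpace ℝ (Fin n)) :
    |u (x + s • z)| ≤ (B * (1 + ‖x‖)) * (1 + ‖z‖) := by
  have hB0 : 0 ≤ B := by simpa using (abs_nonneg _).trans (hB 0)
  refine (hB _).trans ?_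
  rw [mul_assoc]
  gcongr
  have h1 : ‖x + s • z‖ ≤ ‖x‖ + s * ‖z‖ := (norm_add_le _ _).trans (by
    rw [norm_smul, Real.norm_of_nonneg hs])
  nlinarith [norm_nonneg x, norm_nonneg z, mul_le_mul_of_nonneg_right hs1 (norm_nonneg z),
    mul_nonneg (norm_nonneg x) (norm_nonneg z)]

/-- With t = s² the kernel is the L¹-normalised dilation of a fixed profile: the powers of s reduce
to the Jacobian factor s^(-n). -/
theorem scaled_kernel_eq {k : ℕ} {s : ℝ} (hs : 0 < s) (z : EuclideanSpace ℝ (Fin n)) :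
    (s ^ 2) ^ (k + 1) * (s ^ 2 + ‖s • z‖ ^ 2) ^ (-(k : ℝ) - 1 - n / 2) =
      (s ^ n)⁻¹ * (1 + ‖z‖ ^ 2) ^ (-((k : ℝ) + 1 + n / 2)) := by
  rw [norm_smul, Real.norm_of_nonneg hs.le,
    show s ^ 2 + (s * ‖z‖) ^ 2 = s ^ 2 * (1 + ‖z‖ ^ 2) by ring,
    Real.mul_rpow (by positivity) (by positivity), ← mul_assoc,
    show -(k : ℝ) - 1 - n / 2 = -((k : ℝ) + 1 + n / 2) by ring]
  congr 1
  rw [← Real.rpow_natCast s 2, ← Real.rpow_natCast s n, ← Real.rpow_natCast (s ^ _) (k + 1),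
    ← Real.rpow_mul hs.le, ← Real.rpow_mul hs.le, ← Real.rpow_neg hs.le, ← Real.rpow_add hs]
  congr 1
  push_cast
  ring

theorem integral_mul_scaled_kernel {k : ℕ} {s : ℝ} (hs : 0 < s) (x : EuclideanSpace ℝ (Fin n))
    (u : EuclideanSpace ℝ (Fin n) → ℝ) :
    ∫ y, u y * ((s ^ 2) ^ (k + 1) * (s ^ 2 + ‖y - x‖ ^ 2) ^ (-(k : ℝ) - 1 - n / 2)) =
      ∫ z, u (x + s • z) * (1 + ‖z‖ ^ 2) ^ (-((k : ℝ) + 1 + n / 2)) := by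
  have hsn : s ^ n ≠ 0 := by positivity
  rw [← integral_add_left_eq_self _ x]
  have h := Measure.integral_comp_smul (volume : Measure (EuclideanSpace ℝ (Fin n)))
    (fun y => u (x + y) * ((s ^ 2) ^ (k + 1) *
      (s ^ 2 + ‖y‖ ^ 2) ^ (-(k : ℝ) - 1 - n / 2))) s
  simp only [finrank_euclideanSpace_fin, smul_eq_mul, scaled_kernel_eq hs] at h
  rw [abs_of_pos (by positivity), eq_inv_mul_iff_mul_eq₀ hsn, ← integral_const_mul] at h
  simp only [add_sub_cancel_left]
  rw [← h]
  congr 1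
  ext z
  field_simp

theorem integrable_mul_scaled_kernel {k : ℕ} {s : ℝ} (hs : 0 < s) (hs1 : s ≤ 1)
    (x : EuclideanSpace ℝ (Fin n)) {u : EuclideanSpace ℝ (Fin n) → ℝ} (hu : Continuous u) {B : ℝ}
    (hB : ∀ z, |u z| ≤ B * (1 + ‖z‖)) :
    Integrable fun y =>
      u y * ((s ^ 2) ^ (k + 1) * (s ^ 2 + ‖y - x‖ ^ 2) ^ (-(k : ℝ) - 1 - n / 2)) := by
  have hcont : Continuous fun z => u (x + s • z) := by fun_prop
  have h0 := integrable_mul_rpow_one_add_norm_sq (p := (k : ℝ) + 1 + n / 2)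
    (by have : (0 : ℝ) ≤ k := by positivity
        linarith) hcont
    (linear_growth_comp hB x hs.le hs1)
  let g : EuclideanSpace ℝ (Fin n) → ℝ := fun y => u (x + y) * ((s ^ 2) ^ (k + 1) *
    (s ^ 2 + ‖y‖ ^ 2) ^ (-(k : ℝ) - 1 - n / 2))
  have h1 : Integrable fun z => g (s • z) := by
    simp only [g, scaled_kernel_eq hs]
    convert h0.const_mul (s ^ n)⁻¹ using 2
    ring
  have h2 := ((integrable_comp_smul_iff volume g hs.ne').1 h1).comp_sub_right x
  simpa [g] using h2

theorem tendsto_mollification {p : ℝ} (hp : (n : ℝ) + 1 < 2 * p)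
    {u : EuclideanSpace ℝ (Fin n) → ℝ} (hu : Continuous u) {B : ℝ}
    (hB : ∀ z, |u z| ≤ B * (1 + ‖z‖)) (x : EuclideanSpace ℝ (Fin n)) :
    Tendsto (fun j : ℕ => ∫ z, u (x + (1 / ((j : ℝ) + 1)) • z) * (1 + ‖z‖ ^ 2) ^ (-p)) atTop
      (𝓝 (u x * ∫ z : EuclideanSpace ℝ (Fin n), (1 + ‖z‖ ^ 2) ^ (-p))) := by
  have hK : Continuous fun z : EuclideanSpace ℝ (Fin n) => (1 + ‖z‖ ^ 2) ^ (-p) :=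
    (contDiff_rpow_add_norm_sq one_pos _).continuous
  have hB0 : 0 ≤ B := by simpa using (abs_nonneg _).trans (hB 0)
  rw [← integral_const_mul]
  refine tendsto_integral_of_dominated_convergence
    (fun z => ((B * (1 + ‖x‖)) * (1 + ‖z‖)) * (1 + ‖z‖ ^ 2) ^ (-p)) ?_ ?_ ?_ ?_
  · intro j
    exact Continuous.aestronglyMeasurable (by fun_prop)
  · refine integrable_mul_rpow_one_add_norm_sq hp (by fun_prop) (A := B * (1 + ‖x‖)) fun z => ?_
    rw [abs_of_nonneg (by positivity)]
  · refine fun j => Eventually.of_forall fun z => ?_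
    rw [norm_mul, Real.norm_eq_abs, Real.norm_of_nonneg (by positivity)]
    gcongr
    refine linear_growth_comp hB x (by positivity) ?_ z
    rw [div_le_one (by positivity)]
    linarith [(Nat.cast_nonneg j : (0 : ℝ) ≤ j)]
  · refine Eventually.of_forall fun z => Tendsto.mul_const _ ?_
    have h1 : Tendsto (fun j : ℕ => x + (1 / ((j : ℝ) + 1)) • z) atTop (𝓝 (x + (0 : ℝ) • z)) :=
      tendsto_const_nhds.add (tendsto_one_div_add_atTop_nhds_zero_nat.smul_const z)
    rw [zero_smul, add_zero] at h1
    exact (hu.tendsto x).comp h1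

theorem integral_rpow_one_add_norm_sq_pos {p : ℝ} (hp : (n : ℝ) + 1 < 2 * p) :
    0 < ∫ z : EuclideanSpace ℝ (Fin n), (1 + ‖z‖ ^ 2) ^ (-p) := by
  have hK : Continuous fun z : EuclideanSpace ℝ (Fin n) => (1 + ‖z‖ ^ 2) ^ (-p) :=
    (contDiff_rpow_add_norm_sq one_pos _).continuous
  refine integral_pos_of_integrable_nonneg_nonzero (x := 0) hK ?_ (fun z => by positivity) (by simp)
  simpa using integrable_mul_rpow_one_add_norm_sq hp
    (continuous_const (y := (1 : ℝ)) (X := EuclideanSpace ℝ (Fin n))) (A := 1) (by simp)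

end Mollification

/-! ### Vanishing moments and decay of the potential -/

section Moments

variable {n : ℕ}

theorem iterate_laplacian_zero (m : ℕ) :
    Δ^[m] (fun _ : EuclideanSpace ℝ (Fin n) => (0 : ℝ)) = fun _ => 0 := by
  induction m with
  | zero => rfl
  | succ m ih => rw [Function.iterate_succ_apply', ih, InnerProductSpace.laplacian_const]; rfl

/-- Replace p by a cut-off τ, move Δ^m onto ∂_i τ, commute, and move ∂_i back onto u_i. The
integrand becomes (div u) Δ^m τ, whose second factor vanishes on the ball of radius R and whose
first factor vanishes outside it. -/
theorem sum_integral_iterate_laplacian_mul_partialDeriv {m : ℕ} {R : ℝ} (hR : 0 ≤ R)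
    {u : Fin n → EuclideanSpace ℝ (Fin n) → ℝ}
    (hm : 1 ≤ m) (hu : ∀ i, ContDiff ℝ ((2 * m : ℕ) : WithTop ℕ∞) (u i))
    (hf : ∀ i y, R < ‖y‖ → (Δ^[m] (u i)) y = 0)
    (hdiv : ∀ y, R < ‖y‖ → ∑ i, partialDeriv i (u i) y = 0)
    {p : EuclideanSpace ℝ (Fin n) → ℝ} (hp : ContDiff ℝ ∞ p) (hpΔ : Δ^[m] p = fun _ => 0) :
    ∑ i, ∫ y, (Δ^[m] (u i)) y * partialDeriv i p y = 0 := by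
  -- The plateau exceeds R, so that τ = p in a neighbourhood of each point of the closed ball and
  -- all derivatives agree there.
  let θ : ContDiffBump (0 : EuclideanSpace ℝ (Fin n)) := ⟨R + 1, R + 2, by linarith, by linarith⟩
  set τ : EuclideanSpace ℝ (Fin n) → ℝ := fun y => θ y * p y with hτdef
  have hτ : ContDiff ℝ ∞ τ := θ.contDiff.mul hp
  have hτc : HasCompactSupport τ := θ.hasCompactSupport.mul_right
  have hτp (y) (hy : ‖y‖ ≤ R) : τ =ᶠ[𝓝 y] p := by
    filter_upwards [θ.eventuallyEq_one_of_mem_ball (x := y) (by simp [θ]; linarith)] with z hz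
    simp [hτdef, hz]
  have hu1 (i) : ContDiff ℝ 1 (u i) := (hu i).of_le (by
    have : 1 ≤ 2 * m := by omega
    exact_mod_cast this)
  have hmτ := contDiff_infty_iterate_laplacian hτ m
  have hterm (i : Fin n) : ∫ y, (Δ^[m] (u i)) y * partialDeriv i p y =
      -∫ y, partialDeriv i (u i) y * (Δ^[m] τ) y := by
    calc _ = ∫ y, (Δ^[m] (u i)) y * partialDeriv i τ y := by
          congr 1
          ext y
          by_cases hy : ‖y‖ ≤ R
          · simp only [partialDeriv, (hτp y hy).fderiv_eq]
          · rw [hf i y (not_le.1 hy), zero_mul, zero_mul]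
      _ = ∫ y, u i y * partialDeriv i (Δ^[m] τ) y := by
          rw [integral_iterate_laplacian_mul m (hu i) (contDiff_infty_partialDeriv hτ i)
            (hasCompactSupport_partialDeriv hτc i), iterate_laplacian_partialDeriv hτ]
      _ = _ := by
          rw [integral_partialDeriv_mul (hu1 i) (hmτ.of_le (by exact_mod_cast le_top))
            (hasCompactSupport_iterate_laplacian hτc m), neg_neg]
  simp only [hterm]
  rw [Finset.sum_neg_distrib, ← integral_finsetSum, neg_eq_zero]
  · refine integral_eq_zero_of_ae (Eventually.of_forall fun y => ?_)
    simp only [← Finset.sum_mul, Pi.zero_apply]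
    by_cases hy : ‖y‖ ≤ R
    · rw [(iterate_laplacian_congr_nhds (hτp y hy) m).eq_of_nhds, hpΔ, mul_zero]
    · rw [hdiv y (not_le.1 hy), zero_mul]
  · intro i _
    exact ((contDiff_partialDeriv (N := 0) (by simpa using hu1 i) i).continuous.mul
      hmτ.continuous).integrable_of_hasCompactSupport
      (hasCompactSupport_iterate_laplacian hτc m).mul_left

theorem contDiff_coord {N : WithTop ℕ∞} (a : Fin n) :
    ContDiff ℝ N fun y : EuclideanSpace ℝ (Fin n) => y a :=
  (EuclideanSpace.proj a : EuclideanSpace ℝ (Fin n) →L[ℝ] ℝ).contDiff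

theorem partialDeriv_coord (i a : Fin n) :
    partialDeriv i (fun y : EuclideanSpace ℝ (Fin n) => y a) = fun _ => if a = i then 1 else 0 := by
  ext y
  have : HasFDerivAt (fun y : EuclideanSpace ℝ (Fin n) => y a)
      (EuclideanSpace.proj a : EuclideanSpace ℝ (Fin n) →L[ℝ] ℝ) y :=
    (EuclideanSpace.proj a : EuclideanSpace ℝ (Fin n) →L[ℝ] ℝ).hasFDerivAt
  rw [partialDeriv, this.fderiv]
  simp

theorem laplacian_coord (a : Fin n) :
    Δ (fun y : EuclideanSpace ℝ (Fin n) => y a) = fun _ => 0 := by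
  rw [laplacian_eq_sum_partialDeriv (contDiff_coord a)]
  ext y
  simp [partialDeriv_coord, partialDeriv]

theorem contDiff_quadratic {N : WithTop ℕ∞} (a b : Fin n) (c : ℝ) :
    ContDiff ℝ N fun y : EuclideanSpace ℝ (Fin n) => y a * y b - c * ‖y‖ ^ 2 :=
  ((contDiff_coord a).mul (contDiff_coord b)).sub (contDiff_const.mul (contDiff_norm_sq ℝ))

theorem partialDeriv_quadratic (i a b : Fin n) (c : ℝ) :
    partialDeriv i (fun y : EuclideanSpace ℝ (Fin n) => y a * y b - c * ‖y‖ ^ 2) =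
      fun y => (if a = i then 1 else 0) * y b + (if b = i then 1 else 0) * y a - 2 * c * y i := by
  ext y
  have h (a : Fin n) : HasFDerivAt (fun y : EuclideanSpace ℝ (Fin n) => y a)
      (EuclideanSpace.proj a : EuclideanSpace ℝ (Fin n) →L[ℝ] ℝ) y :=
    (EuclideanSpace.proj a : EuclideanSpace ℝ (Fin n) →L[ℝ] ℝ).hasFDerivAt
  have hm : HasFDerivAt (fun y : EuclideanSpace ℝ (Fin n) => y a * y b - c * ‖y‖ ^ 2) _ y :=
    ((h a).mul (h b)).sub (((hasStrictFDerivAt_norm_sq y).hasFDerivAt).const_mul c)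
  rw [partialDeriv, hm.fderiv]
  simp [EuclideanSpace.inner_single_right]
  ring

theorem laplacian_quadratic (a b : Fin n) (c : ℝ) :
    Δ (fun y : EuclideanSpace ℝ (Fin n) => y a * y b - c * ‖y‖ ^ 2) =
      fun _ => 2 * (if a = b then 1 else 0) - 2 * n * c := by
  rw [laplacian_eq_sum_partialDeriv (contDiff_quadratic a b c)]
  ext y
  have h (a : Fin n) : HasFDerivAt (fun y : EuclideanSpace ℝ (Fin n) => y a)
      (EuclideanSpace.proj a : EuclideanSpace ℝ (Fin n) →L[ℝ] ℝ) y :=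
    (EuclideanSpace.proj a : EuclideanSpace ℝ (Fin n) →L[ℝ] ℝ).hasFDerivAt
  have h2 (i : Fin n) : partialDeriv i (partialDeriv i
      (fun y : EuclideanSpace ℝ (Fin n) => y a * y b - c * ‖y‖ ^ 2)) y =
      (if a = i then 1 else 0) * (if b = i then 1 else 0) +
      (if b = i then 1 else 0) * (if a = i then 1 else 0) - 2 * c := by
    have hm : HasFDerivAt (fun y : EuclideanSpace ℝ (Fin n) =>
        (if a = i then (1 : ℝ) else 0) * y b + (if b = i then 1 else 0) * y a - 2 * c * y i) _ y :=
      (((h b).const_mul _).add ((h a).const_mul _)).sub ((h i).const_mul (2 * c))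
    rw [partialDeriv_quadratic, partialDeriv, hm.fderiv]
    by_cases ha : a = i <;> by_cases hb : b = i <;> simp [ha, hb]
  rw [Finset.sum_apply]
  simp only [h2]
  rw [Finset.sum_sub_distrib, Finset.sum_add_distrib]
  simp [eq_comm]
  split_ifs <;> ring

/-- Alternating the two transpositions three times each returns to the original index order, with
sign (-1)³. -/
theorem eq_zero_of_symm_of_antisymm {M : Fin n → Fin n → Fin n → ℝ}
    (hs : ∀ i j l, M i j l = M j i l) (ha : ∀ i j l, M i j l = -M l j i) (i j l : Fin n) :
    M i j l = 0 := by
  have h : M i j l = -M i j l := by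
    calc M i j l = -M l j i := ha i j l
      _ = -M j l i := by rw [hs l j i]
      _ = M i l j := by rw [ha j l i, neg_neg]
      _ = M l i j := hs i l j
      _ = -M j i l := ha l i j
      _ = -M i j l := by rw [hs j i l]
  linarith

section

variable {k : ℕ} {R : ℝ} {u : Fin n → Fin n → EuclideanSpace ℝ (Fin n) → ℝ}

theorem integral_iterate_laplacian_eq_zero (hR : 0 ≤ R)
    (hu : ∀ i j, ContDiff ℝ ((2 * (k + 1) : ℕ) : WithTop ℕ∞) (u i j))
    (hf : ∀ i j y, R < ‖y‖ → (Δ^[k + 1] (u i j)) y = 0)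
    (hdiv : ∀ j y, R < ‖y‖ → ∑ i, partialDeriv i (u i j) y = 0) (i j : Fin n) :
    ∫ y, (Δ^[k + 1] (u i j)) y = 0 := by
  have h := sum_integral_iterate_laplacian_mul_partialDeriv hR (by omega) (fun i => hu i j)
    (fun i => hf i j) (hdiv j) (contDiff_coord i)
    (by rw [Function.iterate_succ_apply, laplacian_coord, iterate_laplacian_zero])
  simp only [partialDeriv_coord, integral_mul_const] at h
  simpa using h

/-- The test polynomial is y_a y_b - c|y|². Its Laplacian is constant, so any c is allowed once a
second Laplacian is available; for k = 0 harmonicity forces n c = δ_ab. -/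
theorem integral_iterate_laplacian_mul_coord_add (hR : 0 ≤ R)
    (hu : ∀ i j, ContDiff ℝ ((2 * (k + 1) : ℕ) : WithTop ℕ∞) (u i j))
    (hf : ∀ i j y, R < ‖y‖ → (Δ^[k + 1] (u i j)) y = 0)
    (hint : ∀ i j l, Integrable fun y => (Δ^[k + 1] (u i j)) y * y l)
    (hdiv : ∀ j y, R < ‖y‖ → ∑ i, partialDeriv i (u i j) y = 0) (a b j : Fin n) {c : ℝ}
    (hc : 1 ≤ k ∨ n * c = if a = b then 1 else 0) :
    (∫ y, (Δ^[k + 1] (u a j)) y * y b) + ∫ y, (Δ^[k + 1] (u b j)) y * y a =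
      2 * c * ∑ i, ∫ y, (Δ^[k + 1] (u i j)) y * y i := by
  have hΔ : Δ^[k + 1] (fun y : EuclideanSpace ℝ (Fin n) => y a * y b - c * ‖y‖ ^ 2) =
      fun _ => 0 := by
    rw [Function.iterate_succ_apply, laplacian_quadratic]
    rcases hc with hk | hc
    · obtain ⟨k', rfl⟩ : ∃ k', k = k' + 1 := ⟨k - 1, by omega⟩
      rw [Function.iterate_succ_apply, InnerProductSpace.laplacian_const]
      exact iterate_laplacian_zero k'
    · rw [← hc, show 2 * (n * c) - 2 * n * c = 0 by ring, iterate_laplacian_zero]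
  have h := sum_integral_iterate_laplacian_mul_partialDeriv hR (by omega) (fun i => hu i j)
    (fun i => hf i j) (hdiv j) (contDiff_quadratic a b c) hΔ
  have hterm (i : Fin n) : ∫ y, (Δ^[k + 1] (u i j)) y *
      partialDeriv i (fun y : EuclideanSpace ℝ (Fin n) => y a * y b - c * ‖y‖ ^ 2) y =
      (if a = i then 1 else 0) * (∫ y, (Δ^[k + 1] (u i j)) y * y b) +
      (if b = i then 1 else 0) * (∫ y, (Δ^[k + 1] (u i j)) y * y a) -
      2 * c * ∫ y, (Δ^[k + 1] (u i j)) y * y i := by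
    rw [← integral_const_mul, ← integral_const_mul, ← integral_const_mul, ← integral_add,
      ← integral_sub]
    · rw [partialDeriv_quadratic]
      congr 1
      ext y
      ring
    · exact ((hint i j b).const_mul _).add ((hint i j a).const_mul _)
    · exact (hint i j i).const_mul _
    · exact (hint i j b).const_mul _
    · exact (hint i j a).const_mul _
  simp only [hterm] at h
  rw [Finset.sum_sub_distrib, Finset.sum_add_distrib, ← Finset.mul_sum] at h
  simp only [ite_mul, one_mul, zero_mul, Finset.sum_ite_eq, Finset.mem_univ, if_true] at h
  linarith

theorem integral_iterate_laplacian_mul_coord_eq_zero (hn : 2 < n) (hR : 0 ≤ R)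
    (hsymm : ∀ i j, u i j = u j i)
    (hu : ∀ i j, ContDiff ℝ ((2 * (k + 1) : ℕ) : WithTop ℕ∞) (u i j))
    (hf : ∀ i j y, R < ‖y‖ → (Δ^[k + 1] (u i j)) y = 0)
    (hint : ∀ i j l, Integrable fun y => (Δ^[k + 1] (u i j)) y * y l)
    (hdiv : ∀ j y, R < ‖y‖ → ∑ i, partialDeriv i (u i j) y = 0)
    (hk : 1 ≤ k ∨ ∀ l, ∑ i, ∫ y, (Δ^[k + 1] (u i i)) y * y l = 0) (i j l : Fin n) :
    ∫ y, (Δ^[k + 1] (u i j)) y * y l = 0 := by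
  set M : Fin n → Fin n → Fin n → ℝ := fun i j l => ∫ y, (Δ^[k + 1] (u i j)) y * y l with hM
  have hs (i j l) : M i j l = M j i l := by simp only [hM]; rw [hsymm i j]
  refine eq_zero_of_symm_of_antisymm (M := M) hs (fun a j b => ?_) i j l
  have hadd (a b j : Fin n) (c : ℝ) (hc : 1 ≤ k ∨ n * c = if a = b then 1 else 0) :
      M a j b + M b j a = 2 * c * ∑ i, M i j i :=
    integral_iterate_laplacian_mul_coord_add hR hu hf hint hdiv a b j hc
  rcases hk with hk | htr
  · have := hadd a b j 0 (Or.inl hk)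
    linarith
  · have hn0 : (n : ℝ) ≠ 0 := by positivity
    -- Contracting the identity over its two symmetric-pair indices: the trace term drops out and v
    -- = (2/n) v remains for the contracted moment v, so (n - 2) v = 0.
    have hv (l : Fin n) : ∑ i, M i l i = 0 := by
      have h1 (j : Fin n) : M j j l + M l j j =
          2 * ((if j = l then 1 else 0) / n) * ∑ i, M i j i :=
        hadd j l j _ (Or.inr (by field_simp))
      have h2 : ∑ j, (M j j l + M l j j) = ∑ j, 2 * ((if j = l then 1 else 0) / n) * ∑ i, M i j i :=
        Finset.sum_congr rfl fun j _ => h1 j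
      have h3 : ∑ j, 2 * ((if j = l then 1 else 0) / n) * ∑ i, M i j i =
          2 * (1 / n) * ∑ i, M i l i := by
        rw [Finset.sum_eq_single l (fun j _ hj => by simp [hj]) (by simp)]
        simp
      have h4 : ∑ j, M l j j = ∑ j, M j l j := Finset.sum_congr rfl fun j _ => hs l j j
      rw [Finset.sum_add_distrib, htr l, zero_add, h3, h4] at h2
      have hn' : (2 : ℝ) < n := by exact_mod_cast hn
      have h5 : ((n : ℝ) - 2) * ∑ i, M i l i = 0 := by
        field_simp at h2
        linarith
      exact (mul_eq_zero.1 h5).resolve_left (by linarith)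
    have := hadd a b j ((if a = b then 1 else 0) / n) (Or.inr (by field_simp))
    rw [hv j, mul_zero] at this
    linarith

end

/-- Taylor's formula at -x: the vanishing moments remove the constant and linear parts, and the
second derivative of the potential has order 2b. The bound is uniform in t, as the limit t → 0
requires. -/
theorem abs_integral_mul_radialPotential_le {b R : ℝ} (hb : b ≤ 0) (hR : 0 ≤ R)
    {f : EuclideanSpace ℝ (Fin n) → ℝ} (hf : Continuous f) (hsupp : ∀ y, R < ‖y‖ → f y = 0)
    (h0 : ∫ y, f y = 0) (h1 : ∀ l, ∫ y, f y * y l = 0) :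
    ∃ C, 0 ≤ C ∧ ∀ t > 0, ∀ x : EuclideanSpace ℝ (Fin n), 2 * R + 1 ≤ ‖x‖ →
      |∫ y, f y * radialPotential b t (y - x)| ≤ C * ‖x‖ ^ (2 * b) := by
  obtain ⟨C, hC0, hC⟩ := radialPotential_bound (n := n) 1 b
  have hfc : HasCompactSupport f := HasCompactSupport.of_support_subset_isCompact
    (isCompact_closedBall 0 R) fun y hy => by
      rw [mem_closedBall_zero_iff]
      by_contra h
      exact hy (hsupp y (not_le.1 h))
  have hint {g : EuclideanSpace ℝ (Fin n) → ℝ} (hg : Continuous g) :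
      Integrable fun y => f y * g y :=
    (hf.mul hg).integrable_of_hasCompactSupport hfc.mul_right
  refine ⟨(∫ y, |f y|) * (C * (1 / 2) ^ (2 * b) * R * R), ?_, fun t ht x hx => ?_⟩
  · have : 0 ≤ ∫ y, |f y| := integral_nonneg fun y => abs_nonneg _
    positivity
  have hx0 : 0 < ‖x‖ := by linarith
  have hΦ : ContDiff ℝ ∞ (radialPotential b t : EuclideanSpace ℝ (Fin n) → ℝ) :=
    contDiff_radialPotential ht b
  set Φ : EuclideanSpace ℝ (Fin n) → ℝ := radialPotential b t with hΦdef
  set M := C * ((1 / 2) ^ (2 * b) * ‖x‖ ^ (2 * b)) with hMdef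
  have hM0 : 0 ≤ M := by positivity
  -- Since |x| ≥ 2R + 1, points of this ball have norm at least |x|/2; this produces the factor
  -- (1/2)^(2b).
  have hd2 : ∀ z ∈ Metric.closedBall (-x) R, ‖fderiv ℝ (fderiv ℝ Φ) z‖ ≤ M := by
    intro z hz
    rw [← norm_iteratedFDeriv_one, norm_iteratedFDeriv_fderiv]
    refine (hC t ht z).trans ?_
    rw [hMdef]
    gcongr
    rw [show 2 * b + 1 - ((1 : ℕ) : ℝ) = 2 * b by push_cast; ring,
      ← Real.mul_rpow (by positivity) (by positivity)]
    refine Real.rpow_le_rpow_of_nonpos (by positivity) ?_ (by linarith)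
    refine le_trans ?_ (Real.le_sqrt_of_sq_le (by linarith) : ‖z‖ ≤ √(t + ‖z‖ ^ 2))
    rw [mem_closedBall_iff_norm] at hz
    have h2 : ‖x‖ ≤ ‖z‖ + ‖z - -x‖ := by
      have := norm_sub_le (z - -x) z
      rw [show z - -x - z = x by abel] at this
      linarith
    linarith
  have hd1 : ∀ z ∈ Metric.closedBall (-x) R, ‖fderiv ℝ Φ z - fderiv ℝ Φ (-x)‖ ≤ M * R := by
    intro z hz
    have := (convex_closedBall (-x) R).norm_image_sub_le_of_norm_fderiv_le (f := fderiv ℝ Φ)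
      (fun z _ => ((hΦ.fderiv_right (m := ∞) le_rfl).differentiable (by simp)) z) hd2
      (Metric.mem_closedBall_self hR) hz
    refine this.trans ?_
    gcongr
    exact mem_closedBall_iff_norm.1 hz
  have hrem : ∀ y, ‖y‖ ≤ R → ‖Φ (y - x) - Φ (-x) - fderiv ℝ Φ (-x) y‖ ≤ M * R * R := by
    intro y hy
    have := (convex_closedBall (-x) R).norm_image_sub_le_of_norm_fderiv_le'
      (fun z _ => (hΦ.differentiable (by simp)) z) hd1
      (Metric.mem_closedBall_self hR) (y := y - x) (by simpa [mem_closedBall_iff_norm] using hy)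
    rw [show y - x - -x = y by abel] at this
    refine this.trans ?_
    gcongr
  have hlin : ∫ y, f y * fderiv ℝ Φ (-x) y = 0 := by
    have e (y : EuclideanSpace ℝ (Fin n)) : f y * fderiv ℝ Φ (-x) y =
        ∑ l, ((t + ‖-x‖ ^ 2) ^ b * (-x) l) * (f y * y l) := by
      rw [(hasFDerivAt_radialPotential ht b (-x)).fderiv]
      simp only [smul_apply, innerSL_apply_apply, PiLp.inner_apply,
        smul_eq_mul, Finset.mul_sum]
      refine Finset.sum_congr rfl fun l _ => ?_
      simp
      ring
    simp only [e]
    rw [integral_finsetSum]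
    · refine Finset.sum_eq_zero fun l _ => ?_
      rw [integral_const_mul, h1 l, mul_zero]
    · exact fun l _ => (hint (contDiff_coord (N := 0) l).continuous).const_mul _
  have key : ∫ y, f y * Φ (y - x) = ∫ y, f y * (Φ (y - x) - Φ (-x) - fderiv ℝ Φ (-x) y) := by
    have hA := hint (g := fun y => Φ (y - x))
      (hΦ.continuous.comp (continuous_id.sub continuous_const))
    have hB := hint (continuous_const : Continuous fun _ : EuclideanSpace ℝ (Fin n) => Φ (-x))
    have hD := hint (fderiv ℝ Φ (-x)).continuous
    simp only [mul_sub]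
    rw [integral_sub (f := fun y => f y * Φ (y - x) - f y * Φ (-x)) (hA.sub hB) hD,
      integral_sub hA hB, hlin, integral_mul_const, h0]
    ring
  rw [key, ← Real.norm_eq_abs]
  refine (norm_integral_le_of_norm_le (g := fun y => |f y| * (M * R * R)) ?_
    (Eventually.of_forall fun y => ?_)).trans (le_of_eq ?_)
  · exact ((hf.integrable_of_hasCompactSupport hfc).abs).mul_const _
  · rw [norm_mul, Real.norm_eq_abs]
    by_cases hy : ‖y‖ ≤ R
    · gcongr
      exact hrem y hy
    · rw [hsupp y (not_le.1 hy)]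
      simp
  · rw [integral_mul_const, hMdef]
    ring

end Moments

/-! ### Convergence at infinity and the cutoff -/

section Asymptotics

variable {n : ℕ}

/-- Green's identity with the difference of two translated kernels: one side tends to κ I (u(x) -
u(x')), where I is the mass of the profile, and the other is controlled by the vanishing moments. -/
theorem abs_sub_le_of_vanishing_moments {k : ℕ} (hk : 2 * ((k : ℝ) - n / 2) + 1 ≤ 0) (hn : 0 < n)
    (hκ : bubbleConst n k ≠ 0) {ε R B : ℝ} (hε : 0 < ε) (hR : 0 ≤ R)
    {u : EuclideanSpace ℝ (Fin n) → ℝ} (hu : ContDiff ℝ ((2 * (k + 1) : ℕ) : WithTop ℕ∞) u)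
    (hub : ∀ y, |u y| ≤ B * (1 + ‖y‖) ^ (1 - ε))
    (hf : ∀ y, R < ‖y‖ → (Δ^[k + 1] u) y = 0) (h0 : ∫ y, (Δ^[k + 1] u) y = 0)
    (h1 : ∀ l, ∫ y, (Δ^[k + 1] u) y * y l = 0) :
    ∃ C, 0 ≤ C ∧ ∀ x x' : EuclideanSpace ℝ (Fin n), 2 * R + 1 ≤ ‖x‖ → 2 * R + 1 ≤ ‖x'‖ →
      |u x - u x'| ≤ C * (‖x‖ ^ (2 * ((k : ℝ) - n / 2)) + ‖x'‖ ^ (2 * ((k : ℝ) - n / 2))) := by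
  set b : ℝ := (k : ℝ) - n / 2 with hb
  set f := Δ^[k + 1] u with hfdef
  have hB0 : 0 ≤ B := by simpa using (abs_nonneg _).trans (hub 0)
  have hlin : ∀ y, |u y| ≤ B * (1 + ‖y‖) := fun y => by
    refine (hub y).trans ?_
    gcongr
    calc (1 + ‖y‖) ^ (1 - ε) ≤ (1 + ‖y‖) ^ (1 : ℝ) :=
          Real.rpow_le_rpow_of_exponent_le (by simp) (by linarith)
      _ = _ := Real.rpow_one _
  have hfcont : Continuous f := continuous_iterate_laplacian (k + 1) hu
  have hfc : HasCompactSupport f := HasCompactSupport.of_support_subset_isCompact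
    (isCompact_closedBall 0 R) fun y hy => by
      rw [mem_closedBall_zero_iff]
      by_contra h
      exact hy (hf y (not_le.1 h))
  obtain ⟨C, hC0, hC⟩ := abs_integral_mul_radialPotential_le (b := b) (by linarith) hR hfcont hf h0 h1
  set p : ℝ := (k : ℝ) + 1 + n / 2 with hp
  have hp' : (n : ℝ) + 1 < 2 * p := by
    have : (0 : ℝ) ≤ k := by positivity
    rw [hp]; linarith
  set I : ℝ := ∫ z : EuclideanSpace ℝ (Fin n), (1 + ‖z‖ ^ 2) ^ (-p) with hI
  have hI0 : 0 < I := integral_rpow_one_add_norm_sq_pos hp'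
  set κ : ℝ := 2 * (k + n / 2) * bubbleConst n k with hκdef
  have hκ0 : 0 < |κ| := by
    have : (0 : ℝ) < n := by exact_mod_cast hn
    refine abs_pos.2 (mul_ne_zero ?_ hκ)
    positivity
  refine ⟨C / (|κ| * I), by positivity, fun x x' hx hx' => ?_⟩
  have hstep (s : ℝ) (hs : 0 < s) (hs1 : s ≤ 1) :
      |κ * ((∫ z, u (x + s • z) * (1 + ‖z‖ ^ 2) ^ (-p)) -
        ∫ z, u (x' + s • z) * (1 + ‖z‖ ^ 2) ^ (-p))| ≤ C * (‖x‖ ^ (2 * b) + ‖x'‖ ^ (2 * b)) := by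
    have ht : 0 < s ^ 2 := by positivity
    set Φ : EuclideanSpace ℝ (Fin n) → ℝ := radialPotential b (s ^ 2) with hΦdef
    have hΦ : ContDiff ℝ ∞ Φ := contDiff_radialPotential ht b
    have hΦs (a : EuclideanSpace ℝ (Fin n)) : ContDiff ℝ ∞ fun y => Φ (y - a) :=
      hΦ.comp (contDiff_id.sub contDiff_const)
    -- The decay requirement holds with equality: 2b + 1 - 2(k + 1) = -n - 1.
    have hid := integral_iterate_laplacian_mul_of_decay hε hu hub hfc ((hΦs x).sub (hΦs x'))
      (d := 2 * b + 1) (radialPotential_sub_bound hk ht x x')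
      (by rw [hb]; push_cast; linarith)
    have hG : Δ^[k + 1] (fun y => Φ (y - x) - Φ (y - x')) = fun y =>
        κ * ((s ^ 2) ^ (k + 1) * (s ^ 2 + ‖y - x‖ ^ 2) ^ (-(k : ℝ) - 1 - n / 2)) -
        κ * ((s ^ 2) ^ (k + 1) * (s ^ 2 + ‖y - x'‖ ^ 2) ^ (-(k : ℝ) - 1 - n / 2)) := by
      have := iterate_laplacian_linear_combination (k + 1) (hΦs x) (hΦs x') 1 (-1)
      rw [iterate_laplacian_comp_sub, iterate_laplacian_comp_sub, hΦdef,
        iterate_laplacian_radialPotential ht] at this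
      convert this using 2
      · ext y; ring
      · ring
    have hright : ∫ y, u y * (Δ^[k + 1] (fun y => Φ (y - x) - Φ (y - x'))) y =
        κ * ((∫ z, u (x + s • z) * (1 + ‖z‖ ^ 2) ^ (-p)) -
          ∫ z, u (x' + s • z) * (1 + ‖z‖ ^ 2) ^ (-p)) := by
      rw [hp, ← integral_mul_scaled_kernel hs, ← integral_mul_scaled_kernel hs,
        ← integral_sub (integrable_mul_scaled_kernel hs hs1 x hu.continuous hlin)
          (integrable_mul_scaled_kernel hs hs1 x' hu.continuous hlin), ← integral_const_mul, hG]
      congr 1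
      ext y
      ring
    have hint (a : EuclideanSpace ℝ (Fin n)) : Integrable fun y => f y * Φ (y - a) :=
      (hfcont.mul (hΦs a).continuous).integrable_of_hasCompactSupport hfc.mul_right
    rw [← hright, ← hid]
    simp only [mul_sub]
    rw [integral_sub (hint x) (hint x'), mul_add]
    exact (abs_sub _ _).trans (add_le_add (hC _ ht x hx) (hC _ ht x' hx'))
  have hlim := (((tendsto_mollification hp' hu.continuous hlin x).sub
    (tendsto_mollification hp' hu.continuous hlin x')).const_mul κ).abs
  -- The bound in `hstep` does not involve s, so it survives s = 1/(j+1) → 0.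
  have hle := le_of_tendsto hlim (Eventually.of_forall fun j : ℕ =>
    hstep (1 / ((j : ℝ) + 1)) (by positivity) (by
      rw [div_le_one (by positivity)]
      linarith [(Nat.cast_nonneg j : (0 : ℝ) ≤ j)]))
  rw [← hI] at hle
  clear_value I κ
  rw [← sub_mul, abs_mul κ, abs_mul _ I, abs_of_pos hI0] at hle
  rw [div_mul_eq_mul_div, le_div_iff₀ (mul_pos hκ0 hI0)]
  linarith

/-- The limit is taken along one coordinate ray; letting x' run to infinity along it gives the rate
at every x. -/
theorem exists_limit_of_abs_sub_le (hn : 0 < n) {C R a : ℝ} (ha : a < 0) (hR : 0 < R)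
    {u : EuclideanSpace ℝ (Fin n) → ℝ}
    (h : ∀ x x' : EuclideanSpace ℝ (Fin n), R ≤ ‖x‖ → R ≤ ‖x'‖ →
      |u x - u x'| ≤ C * (‖x‖ ^ a + ‖x'‖ ^ a)) :
    ∃ c, ∀ x, R ≤ ‖x‖ → |u x - c| ≤ C * ‖x‖ ^ a := by
  let e : ℕ → EuclideanSpace ℝ (Fin n) := fun j => EuclideanSpace.single ⟨0, hn⟩ (R + j)
  have he (j : ℕ) : ‖e j‖ = R + j := by
    simp only [e, PiLp.norm_single]
    exact Real.norm_of_nonneg (by positivity)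
  have hR' (j : ℕ) : R ≤ ‖e j‖ := by rw [he]; simp
  have hC : 0 ≤ C := by
    have h' := (abs_nonneg _).trans (h (e 0) (e 0) (hR' 0) (hR' 0))
    have : 0 < ‖e 0‖ ^ a := Real.rpow_pos_of_pos (hR.trans_le (hR' 0)) a
    by_contra hC
    nlinarith
  have h0 : Tendsto (fun j => ‖e j‖ ^ a) atTop (𝓝 0) := by
    have h1 : Tendsto (fun j : ℕ => R + (j : ℝ)) atTop atTop :=
      tendsto_atTop_add_const_left _ _ tendsto_natCast_atTop_atTop
    have h2 := (tendsto_rpow_neg_atTop (y := -a) (by linarith)).comp h1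
    simpa [Function.comp_def, he] using h2
  have hanti {j l : ℕ} (hjl : j ≤ l) : ‖e l‖ ^ a ≤ ‖e j‖ ^ a := by
    refine Real.rpow_le_rpow_of_nonpos (hR.trans_le (hR' j)) ?_ ha.le
    rw [he, he]
    have : (j : ℝ) ≤ l := by exact_mod_cast hjl
    linarith
  have hcauchy : CauchySeq fun j => u (e j) := by
    refine cauchySeq_of_le_tendsto_0 (fun N => C * (‖e N‖ ^ a + ‖e N‖ ^ a))
      (fun j l N hj hl => ?_) ?_
    · rw [Real.dist_eq]
      refine (h _ _ (hR' j) (hR' l)).trans ?_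
      have := hanti hj
      have := hanti hl
      gcongr
    · simpa using (h0.add h0).const_mul C
  obtain ⟨c, hc⟩ := cauchySeq_tendsto_of_complete hcauchy
  refine ⟨c, fun x hx => ?_⟩
  have h2 : Tendsto (fun j => C * (‖x‖ ^ a + ‖e j‖ ^ a)) atTop (𝓝 (C * (‖x‖ ^ a + 0))) :=
    (tendsto_const_nhds.add h0).const_mul C
  rw [add_zero] at h2
  exact le_of_tendsto_of_tendsto (tendsto_const_nhds.sub hc).abs h2
    (Eventually.of_forall fun j => h x (e j) hx (hR' j))

theorem bubbleConst_ne_zero {k : ℕ} (hn : 0 < n) (h : ∀ j < k, (j : ℝ) + 1 ≠ n / 2) :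
    bubbleConst n k ≠ 0 := by
  have : (0 : ℝ) < n := by exact_mod_cast hn
  refine Finset.prod_ne_zero_iff.2 fun j hj => ?_
  have := sub_ne_zero.2 (h j (Finset.mem_range.1 hj))
  have : (j : ℝ) + n / 2 ≠ 0 := by positivity
  simp_all

theorem laplacian_sum {ι : Type*} (s : Finset ι) {F : ι → EuclideanSpace ℝ (Fin n) → ℝ}
    (hF : ∀ i, ContDiff ℝ 2 (F i)) :
    Δ (fun y => ∑ i ∈ s, F i y) = fun y => ∑ i ∈ s, (Δ (F i)) y := by
  classical
  induction s using Finset.induction_on with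
  | empty =>
    simp only [Finset.sum_empty]
    rw [InnerProductSpace.laplacian_const]; rfl
  | insert a s ha ih =>
    simp only [Finset.sum_insert ha]
    ext x
    have := ContDiffAt.laplacian_add (x := x) (hF a).contDiffAt
      (f₂ := fun y => ∑ i ∈ s, F i y) (ContDiff.sum fun i _ => hF i).contDiffAt
    rw [ih] at this
    exact this

theorem isOpen_exteriorRegion (ρ : ℝ) : IsOpen (exteriorRegion n ρ) :=
  isOpen_lt continuous_const continuous_norm

/-- A radial cutoff, equal to `0` for `|x| ≤ ρ + 1` and to `1` for `|x| ≥ ρ + 2`. -/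
theorem exists_exterior_cutoff {ρ : ℝ} (hρ : 0 < ρ) :
    ∃ χ : EuclideanSpace ℝ (Fin n) → ℝ, ContDiff ℝ ∞ χ ∧ (∀ x, 0 ≤ χ x ∧ χ x ≤ 1) ∧
      (∀ x, ‖x‖ ≤ ρ + 1 → χ x = 0) ∧ ∀ x, ρ + 2 ≤ ‖x‖ → χ x = 1 := by
  let θ : ContDiffBump (0 : EuclideanSpace ℝ (Fin n)) :=
    ⟨ρ + 1, ρ + 2, by linarith, by linarith⟩
  refine ⟨fun x => 1 - θ x, contDiff_const.sub θ.contDiff, fun x => ⟨?_, ?_⟩, fun x hx => ?_,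
    fun x hx => ?_⟩
  · linarith [θ.le_one (x := x)]
  · linarith [θ.nonneg (x := x)]
  · change 1 - θ x = 0
    rw [θ.one_of_mem_closedBall (by simpa [θ] using hx), sub_self]
  · change 1 - θ x = 1
    rw [θ.zero_of_le_dist (by simpa [θ] using hx), sub_zero]

/-- Nothing is known about `v` for |x| ≤ ρ, but the cutoff vanishes up to radius ρ + 1, hence near
each such point. -/
theorem contDiff_cutoff_mul {ρ : ℝ} {N : ℕ} {χ v : EuclideanSpace ℝ (Fin n) → ℝ}
    (hχ : ContDiff ℝ ∞ χ) (hχ0 : ∀ x, ‖x‖ ≤ ρ + 1 → χ x = 0)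
    (hv : ContDiffOn ℝ N v (exteriorRegion n ρ)) : ContDiff ℝ N fun x => χ x * v x := by
  rw [contDiff_iff_contDiffAt]
  intro x
  by_cases hx : ρ < ‖x‖
  · exact (hχ.of_le (natCast_le_contDiff_infty N)).contDiffAt.mul
      (hv.contDiffAt ((isOpen_exteriorRegion ρ).mem_nhds hx))
  · have hlt : ∀ᶠ y in 𝓝 x, ‖y‖ < ρ + 1 :=
      (continuous_norm.tendsto x).eventually_lt_const (by linarith)
    refine (contDiffAt_const (c := (0 : ℝ))).congr_of_eventuallyEq ?_
    filter_upwards [hlt] with y hy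
    rw [hχ0 y hy.le, zero_mul]

/-- With ε ≤ 1 the weight is at least 1, so it also absorbs the values on a compact ball. -/
theorem exists_growth_bound {ε : ℝ} (hε : ε ≤ 1) {u v : EuclideanSpace ℝ (Fin n) → ℝ} {δ : ℝ}
    (hδ : ε ≤ δ) (hu : Continuous u) (huv : ∀ x, |u x| ≤ |v x|)
    (hv : v =O[Bornology.cobounded _] fun x => ‖x‖ ^ (1 - δ)) :
    ∃ B, ∀ x, |u x| ≤ B * (1 + ‖x‖) ^ (1 - ε) := by
  obtain ⟨K, hK0, hK⟩ := hv.exists_nonneg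
  obtain ⟨r, -, hr⟩ := (hasBasis_cobounded_norm).eventually_iff.1 hK.bound
  obtain ⟨M, hM⟩ := (isCompact_closedBall (0 : EuclideanSpace ℝ (Fin n))
    (max r 1)).exists_bound_of_continuousOn hu.continuousOn
  have hM0 : 0 ≤ M := (norm_nonneg _).trans (hM 0 (by simp))
  refine ⟨M + K, fun x => ?_⟩
  have hone : 1 ≤ (1 + ‖x‖) ^ (1 - ε) := Real.one_le_rpow (by simp) (by linarith)
  by_cases hx : ‖x‖ ≤ max r 1
  · have := hM x (by simpa using hx)
    rw [Real.norm_eq_abs] at this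
    nlinarith
  · have hx' := not_le.1 hx
    have h1 : 1 < ‖x‖ := (le_max_right _ _).trans_lt hx'
    have h2 : |v x| ≤ K * ‖x‖ ^ (1 - δ) := by
      have := hr (x := x) ((le_max_left r 1).trans hx'.le)
      rwa [Real.norm_eq_abs, Real.norm_of_nonneg (by positivity)] at this
    have h3 : ‖x‖ ^ (1 - δ) ≤ (1 + ‖x‖) ^ (1 - ε) :=
      (Real.rpow_le_rpow_of_exponent_le h1.le (by linarith)).trans
        (Real.rpow_le_rpow (norm_nonneg _) (by linarith) (by linarith))
    have h4 : 0 ≤ M * (1 + ‖x‖) ^ (1 - ε) := by positivity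
    calc |u x| ≤ K * ‖x‖ ^ (1 - δ) := (huv x).trans h2
      _ ≤ K * (1 + ‖x‖) ^ (1 - ε) := by gcongr
      _ ≤ _ := by rw [add_mul]; linarith

end Asymptotics

/-! ### Assembly -/

theorem proposition2p2 (n k : ℕ) (hn : 2 < n) (ρ : ℝ) (hρ : 0 < ρ) (ε : ℝ) (hε : 0 < ε)
    (h : TensorField2 n)
    (hreg : TensorField2.IsCm (2 * (k + 1)) h (exteriorRegion n ρ))
    (hsymm : ∀ x ∈ exteriorRegion n ρ, (h x).IsSymm)
    (hlap : ∀ x ∈ exteriorRegion n ρ, (TensorField2.laplacian^[k + 1] h) x = 0)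
    (hdiv : ∀ x ∈ exteriorRegion n ρ, TensorField2.divergence h x = 0)
    (hgrowth : TensorField2.IsBigOPow h (1 - ε))
    (hk : (1 ≤ k ∧ (k : ℝ) ≤ (n : ℝ) / 2 - 1) ∨ (k = 1 ∧ n = 3) ∨
      (k = 0 ∧ ∀ x ∈ exteriorRegion n ρ, (h x).trace = 0)) :
    ∃ hc : Matrix (Fin n) (Fin n) ℝ, hc.IsSymm ∧
      TensorField2.IsBigOPow (fun x => h x - hc) (2 * (k : ℝ) - (n : ℝ)) := by
  have hn' : (2 : ℝ) < n := by exact_mod_cast hn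
  obtain ⟨χ, hχ, hχ01, hχ0, hχ1⟩ := exists_exterior_cutoff (n := n) hρ
  set u : Fin n → Fin n → EuclideanSpace ℝ (Fin n) → ℝ := fun i j x => χ x * h x i j with hudef
  set R : ℝ := ρ + 2 with hRdef
  have hR : 0 ≤ R := by linarith
  have hu (i j) : ContDiff ℝ ((2 * (k + 1) : ℕ) : WithTop ℕ∞) (u i j) :=
    contDiff_cutoff_mul hχ hχ0 (hreg i j)
  have huh (i j) (y : EuclideanSpace ℝ (Fin n)) (hy : R < ‖y‖) :
      u i j =ᶠ[𝓝 y] fun z => h z i j := by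
    filter_upwards [(continuous_norm.tendsto y).eventually_const_lt hy] with z hz
    simp [hudef, hχ1 z hz.le]
  have hext {y : EuclideanSpace ℝ (Fin n)} (hy : R < ‖y‖) : y ∈ exteriorRegion n ρ := by
    change ρ < ‖y‖
    linarith
  have hf (i j) (y) (hy : R < ‖y‖) : (Δ^[k + 1] (u i j)) y = 0 := by
    rw [(iterate_laplacian_congr_nhds (huh i j y hy) (k + 1)).eq_of_nhds,
      ← TensorField2.iterate_laplacian_apply h, hlap y (hext hy)]
    rfl
  have hdivu (j) (y) (hy : R < ‖y‖) : ∑ i, partialDeriv i (u i j) y = 0 := by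
    simp only [partialDeriv, (huh _ j y hy).fderiv_eq]
    exact congrFun (hdiv y (hext hy)) j
  have hzero {x : EuclideanSpace ℝ (Fin n)} (hx : x ∉ exteriorRegion n ρ) : χ x = 0 :=
    hχ0 x (by have : ‖x‖ ≤ ρ := not_lt.1 hx
              linarith)
  have hus (i j) : u i j = u j i := by
    ext x
    by_cases hx : x ∈ exteriorRegion n ρ
    · simp only [hudef, (hsymm x hx).apply i j]
    · simp only [hudef, hzero hx, zero_mul]
  have hfcont (i j) : Continuous (Δ^[k + 1] (u i j)) := continuous_iterate_laplacian _ (hu i j)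
  have hint (i j l) : Integrable fun y => (Δ^[k + 1] (u i j)) y * y l := by
    refine ((hfcont i j).mul (contDiff_coord (N := 0) l).continuous).integrable_of_hasCompactSupport
      (HasCompactSupport.mul_right ?_)
    refine HasCompactSupport.of_support_subset_isCompact (isCompact_closedBall 0 R) fun y hy => ?_
    rw [mem_closedBall_zero_iff]
    by_contra h
    exact hy (hf i j y (not_le.1 h))
  have htrace : 1 ≤ k ∨ ∀ l, ∑ i, ∫ y, (Δ^[k + 1] (u i i)) y * y l = 0 := by
    rcases hk with hk | hk | ⟨rfl, htr⟩
    · exact Or.inl hk.1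
    · exact Or.inl hk.1.ge
    · refine Or.inr fun l => ?_
      rw [← integral_finsetSum _ fun i _ => hint i i l]
      refine integral_eq_zero_of_ae (Eventually.of_forall fun y => ?_)
      -- The cutoff is scalar, so tracelessness holds on the whole space, including the transition
      -- shell, and passes to `f`.
      have hsum : (fun x => ∑ i, u i i x) = fun _ => 0 := by
        ext x
        simp only [hudef, ← Finset.mul_sum]
        by_cases hx : x ∈ exteriorRegion n ρ
        · rw [show ∑ i, h x i i = 0 from htr x hx, mul_zero]
        · rw [hzero hx, zero_mul]
      have hΔ := congrFun (laplacian_sum Finset.univ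
        (fun i => (hu i i).of_le (by simp))) y
      rw [hsum, InnerProductSpace.laplacian_const] at hΔ
      simp only [← Finset.sum_mul, zero_add, Function.iterate_one, ← hΔ]
      simp
  have hexp : 2 * ((k : ℝ) - n / 2) + 1 ≤ 0 := by
    rcases hk with hk | ⟨rfl, rfl⟩ | ⟨rfl, -⟩
    · linarith
    · norm_num
    · push_cast; linarith
  -- A factor vanishes only if j + 1 = n/2 for some j < k: excluded by k < n/2 in the first case, by
  -- parity when n = 3, and vacuously when k = 0.
  have hκ : bubbleConst n k ≠ 0 := by
    refine bubbleConst_ne_zero (by omega) fun j hj => ?_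
    have hj' : (j : ℝ) + 1 ≤ k := by exact_mod_cast hj
    rcases hk with hk | ⟨rfl, rfl⟩ | ⟨rfl, -⟩
    · linarith
    · obtain rfl : j = 0 := by omega
      norm_num
    · omega
  have hlimit (i j) : ∃ C c, ∀ x, 2 * R + 1 ≤ ‖x‖ →
      |u i j x - c| ≤ C * ‖x‖ ^ (2 * ((k : ℝ) - n / 2)) := by
    -- ε is replaced by min ε 1, which only weakens the growth assumption.
    obtain ⟨B, hB⟩ := exists_growth_bound (min_le_right ε 1) (min_le_left ε 1)
      (hu i j).continuous (fun x => by
        rw [hudef, abs_mul, abs_of_nonneg (hχ01 x).1]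
        exact mul_le_of_le_one_left (abs_nonneg _) (hχ01 x).2) (hgrowth i j)
    obtain ⟨C, -, hC⟩ := abs_sub_le_of_vanishing_moments hexp (by omega) hκ
      (lt_min hε one_pos) hR (hu i j) hB (hf i j)
      (integral_iterate_laplacian_eq_zero hR hu hf hdivu i j)
      (integral_iterate_laplacian_mul_coord_eq_zero hn hR hus hu hf hint hdivu htrace i j)
    exact ⟨C, exists_limit_of_abs_sub_le (by omega) (by linarith) (by linarith) hC⟩
  choose C c hc using hlimit
  -- The limits were chosen separately for each (i, j); using the ordered pair makes the matrix
  -- symmetric by construction.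
  refine ⟨Matrix.of fun i j => c (min i j) (max i j), ?_, fun i j => ?_⟩
  · ext i j
    simp [min_comm, max_comm]
  · refine Asymptotics.IsBigO.of_bound (C (min i j) (max i j)) ?_
    filter_upwards [eventually_cobounded_le_norm (2 * R + 1)] with x hx
    have hxR : R ≤ ‖x‖ := by linarith
    have huij : u (min i j) (max i j) x = h x i j := by
      rcases le_total i j with hij | hij
      · simp [hudef, hij, hχ1 x hxR]
      · rw [min_eq_right hij, max_eq_left hij, hus]
        simp [hudef, hχ1 x hxR]
    have := hc (min i j) (max i j) x hx
    rw [huij] at this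
    rw [Real.norm_eq_abs, Real.norm_of_nonneg (Real.rpow_nonneg (norm_nonneg x) _),
      show 2 * (k : ℝ) - n = 2 * ((k : ℝ) - n / 2) by ring]
    exact this
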